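/- Let $0<p<1$ and let $\Gamma$ be a set. A $p$-Banach space is a real vector space with a complete $p$-norm ($\|x\|=0$ only if $x=0$, $\|cx\|=|c|\|x\|$, $\|x+y\|^p\le\|x\|^p+\|y\|^p$). A $p$-Banach lattice is a real vector lattice that is a $p$-Banach space under a norm with $\|x\|\le\|y\|$ whenever $|x|\le|y|$. It is $p$-convex if for some $C>0$ one has $\big\|(\sum_{k=1}^n|x_k|^p)^{1/p}\big\|\le C(\sum_{k=1}^n\|x_k\|^p)^{1/p}$ for all $n$ and all $x_1,\dots,x_n$ (Yudin–Krivine functional calculus). Homomorphisms are bounded linear maps preserving $\vee$ and $\wedge$. A lattice quotient is a surjective homomorphism $\pi:X\to Z$ with $\|z\|=\inf\{\|x\|:\pi x=z\}$ for all $z\in Z$. Let $\mathbf{pBL}$ be the category of $p$-Banach lattices and homomorphisms, and $\mathbf{pBL}^{(p)}$ its full subcategory of $p$-convex $p$-Banach lattices. An object $P$ of one of these categories is projective in it if there is $\lambda\ge1$ such that, for every lattice quotient $\pi:X\to Z$ in the category and every homomorphism $T:P\to Z$, there is a homomorphism $\tilde T:P\to X$ with $\pi\tilde T=T$ and $\|\tilde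 T\|\le\lambda\|T\|$. The free $p$-Banach lattice $\operatorname{FpBL}[E]$ over a $p$-Banach space $E$ is a $p$-Banach lattice with a linear isometric embedding $\delta:E\to\operatorname{FpBL}[E]$ such that every bounded linear map $T$ from $E$ to a $p$-Banach lattice $X$ has a unique homomorphism $\hat T:\operatorname{FpBL}[E]\to X$ with $\hat T\delta=T$, and $\|\hat T\|=\|T\|$. Consider $\ell_p(\Gamma)$ with its usual $p$-norm and the coordinatewise order. Then: 1. $\ell_p(\Gamma)$ is a projective object of $\mathbf{pBL}$ if and only if $\Gamma$ is countable (finite or countably infinite). 2. $\ell_p(\Gamma)$ is a projective object of $\mathbf{pBL}^{(p)}$ (in particular, an object of it) if and only if $\Gamma$ is countable. 3. If $\Gamma$ is countable, then $\operatorname{FpBL}[\ell_p(\Gamma)]$ exists and $\ell_p(\Gamma)$ is a lattice-complemented sublattice of it, that is, there are homomorphisms $\alpha:\ell_p(\Gamma)\to\operatorname{FpBL}[\ell_p(\Gamma)]$ and $\beta:\operatorname{FpBL}[\ell_p(\Gamma)]\to\ell_p(\Gamma)$ with $\beta\alpha=\mathrm{Id}$. -/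

import Mathlib

open Filter Topology
open scoped ENNReal

universe u

/-! ### `p`-Banach spaces -/

/-- `‖·‖` is a complete `p`-norm on the real vector space `E`. Completeness is that of the linear
topology whose basic neighbourhoods of `0` are the balls `{x | ‖x‖ < ε}`; this topology is
metrizable, so completeness is completeness for Cauchy sequences. -/
class IsPBanach (p : ℝ) (E : Type u) [AddCommGroup E] [Module ℝ E] [Norm E] : Prop where
  norm_nonneg : ∀ x : E, 0 ≤ ‖x‖
  eq_zero_of_norm_eq_zero : ∀ x : E, ‖x‖ = 0 → x = 0
  norm_smul : ∀ (c : ℝ) (x : E), ‖c • x‖ = |c| * ‖x‖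
  norm_add_rpow_le : ∀ x y : E, ‖x + y‖ ^ p ≤ ‖x‖ ^ p + ‖y‖ ^ p
  complete : ∀ v : ℕ → E, (∀ ε > 0, ∃ N, ∀ m ≥ N, ∀ n ≥ N, ‖v m - v n‖ < ε) →
    ∃ x : E, Tendsto (fun n => ‖v n - x‖) atTop (𝓝 0)

/-- A linear map between `p`-normed spaces is bounded (equivalently, continuous). -/
def IsBoundedOp {E F : Type*} [AddCommGroup E] [Module ℝ E] [Norm E]
    [AddCommGroup F] [Module ℝ F] [Norm F] (T : E →ₗ[ℝ] F) : Prop :=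
  ∃ C : ℝ, ∀ x, ‖T x‖ ≤ C * ‖x‖

/-- The norm `sup {‖T x‖ : ‖x‖ ≤ 1}` of an operator; it is only used for bounded operators, for
which the supremum is that of a nonempty bounded set of reals. -/
noncomputable def opNorm {E F : Type*} [AddCommGroup E] [Module ℝ E] [Norm E]
    [AddCommGroup F] [Module ℝ F] [Norm F] (T : E →ₗ[ℝ] F) : ℝ :=
  sSup {r : ℝ | ∃ x : E, ‖x‖ ≤ 1 ∧ ‖T x‖ = r}

/-! ### `p`-Banach lattices and their homomorphisms -/

/-- A `p`-Banach lattice: a real vector lattice with a complete lattice `p`-norm. -/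
structure PBanachLattice (p : ℝ) : Type (u + 1) where
  carrier : Type u
  [addCommGroup : AddCommGroup carrier]
  [module : Module ℝ carrier]
  [lattice : Lattice carrier]
  [norm : Norm carrier]
  [isPBanach : IsPBanach p carrier]
  add_le_add : ∀ x y z : carrier, x ≤ y → x + z ≤ y + z
  smul_le_smul : ∀ (c : ℝ) (x y : carrier), 0 ≤ c → x ≤ y → c • x ≤ c • y
  solid : ∀ x y : carrier, |x| ≤ |y| → ‖x‖ ≤ ‖y‖

instance (p : ℝ) : CoeSort (PBanachLattice.{u} p) (Type u) := ⟨PBanachLattice.carrier⟩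

attribute [instance] PBanachLattice.addCommGroup PBanachLattice.module PBanachLattice.lattice
  PBanachLattice.norm PBanachLattice.isPBanach

/-- A linear map between vector lattices that preserves the lattice operations. -/
def PreservesLattice {E F : Type*} [AddCommGroup E] [Module ℝ E] [Lattice E]
    [AddCommGroup F] [Module ℝ F] [Lattice F] (T : E →ₗ[ℝ] F) : Prop :=
  (∀ x y, T (x ⊔ y) = T x ⊔ T y) ∧ (∀ x y, T (x ⊓ y) = T x ⊓ T y)

/-- (Lattice) homomorphisms of `p`-Banach lattices: bounded operators preserving the lattice
operations. -/
def IsLatticeHom {p : ℝ} {X Y : PBanachLattice.{u} p} (T : X →ₗ[ℝ] Y) : Prop :=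
  PreservesLattice T ∧ IsBoundedOp T

/-- A lattice quotient: a surjective homomorphism such that the norm of the target is the quotient
norm `‖z‖ = inf {‖x‖ : π x = z}`. -/
def IsLatticeQuotient {p : ℝ} {X Z : PBanachLattice.{u} p} (π : X →ₗ[ℝ] Z) : Prop :=
  IsLatticeHom π ∧ Function.Surjective π ∧ ∀ z : Z, IsGLB {r : ℝ | ∃ x : X, π x = z ∧ ‖x‖ = r} ‖z‖

/-! ### `p`-convexity -/

/-- The vector lattice `H_n` of continuous positively homogeneous functions `ℝⁿ → ℝ`. -/
def posHom (n : ℕ) : Submodule ℝ ((Fin n → ℝ) → ℝ) where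
  carrier := {f | Continuous f ∧ ∀ (c : ℝ) (a : Fin n → ℝ), 0 ≤ c → f (c • a) = c * f a}
  add_mem' := by
    rintro f g ⟨hf, hf'⟩ ⟨hg, hg'⟩
    refine ⟨hf.add hg, fun c a hc => ?_⟩
    simp only [Pi.add_apply, hf' c a hc, hg' c a hc, mul_add]
  zero_mem' := ⟨continuous_const, fun c a _ => by simp⟩
  smul_mem' := by
    rintro r f ⟨hf, hf'⟩
    refine ⟨hf.const_smul r, fun c a hc => ?_⟩
    simp only [Pi.smul_apply, smul_eq_mul, hf' c a hc]
    ring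

/-- `H_n` carries the pointwise order and lattice operations. -/
noncomputable instance (n : ℕ) : Lattice (posHom n) :=
  Subtype.lattice (P := fun f : (Fin n → ℝ) → ℝ => f ∈ posHom n)
    (by
      rintro f g ⟨hf, hf'⟩ ⟨hg, hg'⟩
      refine ⟨hf.sup hg, fun c a hc => ?_⟩
      simp only [Pi.sup_apply, hf' c a hc, hg' c a hc]
      exact (mul_max_of_nonneg _ _ hc).symm)
    (by
      rintro f g ⟨hf, hf'⟩ ⟨hg, hg'⟩
      refine ⟨hf.inf hg, fun c a hc => ?_⟩
      simp only [Pi.inf_apply, hf' c a hc, hg' c a hc]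
      exact (mul_min_of_nonneg _ _ hc).symm)

/-- The `i`-th coordinate function in `H_n`. -/
def posHomCoord {n : ℕ} (i : Fin n) : posHom n :=
  ⟨fun a => a i, continuous_apply i, fun c a _ => by simp⟩

/-- The function `a ↦ (∑ |a_k|ᵖ)^(1/p)` in `H_n`. -/
noncomputable def posHomLp {p : ℝ} (hp : 0 < p) (n : ℕ) : posHom n :=
  ⟨fun a => (∑ k, |a k| ^ p) ^ (1 / p), by
    refine ⟨?_, fun c a hc => ?_⟩
    · refine Continuous.rpow_const ?_ (fun _ => Or.inr (by positivity))
      refine continuous_finsetSum _ fun k _ => ?_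
      exact ((continuous_apply k).abs).rpow_const (fun _ => Or.inr hp.le)
    · have h1 : ∀ k, |(c • a) k| ^ p = c ^ p * |a k| ^ p := fun k => by
        rw [Pi.smul_apply, smul_eq_mul, abs_mul, abs_of_nonneg hc,
          Real.mul_rpow hc (abs_nonneg _)]
      simp only [h1, ← Finset.mul_sum]
      rw [Real.mul_rpow (Real.rpow_nonneg hc _)
        (Finset.sum_nonneg fun k _ => Real.rpow_nonneg (abs_nonneg _) _),
        ← Real.rpow_mul hc, mul_one_div_cancel hp.ne', Real.rpow_one]⟩

/-- Lattice `p`-convexity: `‖(∑ |x_k|ᵖ)^(1/p)‖ ≤ C (∑ ‖x_k‖ᵖ)^(1/p)`. The element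
`(∑ |x_k|ᵖ)^(1/p)` is given by the Yudin-Krivine functional calculus: it is the image of the
function `a ↦ (∑ |a_k|ᵖ)^(1/p)` under the linear lattice homomorphism `Φ : H_n → X` that maps the
`k`-th coordinate function to `x_k` (there is exactly one such `Φ`). -/
def IsPConvex {p : ℝ} (hp : 0 < p) (X : PBanachLattice.{u} p) : Prop :=
  ∃ C : ℝ, 0 < C ∧ ∀ (n : ℕ) (x : Fin n → X) (Φ : posHom n →ₗ[ℝ] X),
    PreservesLattice Φ → (∀ k, Φ (posHomCoord k) = x k) →
      ‖Φ (posHomLp hp n)‖ ≤ C * (∑ k, ‖x k‖ ^ p) ^ (1 / p)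

/-! ### Projective objects -/

/-- `l`-projectivity of `P` in the full subcategory of `p`-Banach lattices given by `𝒞`. -/
def IsProjectiveConst {p : ℝ} (𝒞 : PBanachLattice.{u} p → Prop) (l : ℝ)
    (P : PBanachLattice.{u} p) : Prop :=
  ∀ (X Z : PBanachLattice.{u} p), 𝒞 X → 𝒞 Z →
    ∀ π : X →ₗ[ℝ] Z, IsLatticeQuotient π → ∀ T : P →ₗ[ℝ] Z, IsLatticeHom T →
      ∃ S : P →ₗ[ℝ] X, IsLatticeHom S ∧ π ∘ₗ S = T ∧ opNorm S ≤ l * opNorm T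

/-- `P` is a projective object of the category `pBL` of `p`-Banach lattices. -/
def IsProjectivePBL {p : ℝ} (P : PBanachLattice.{u} p) : Prop :=
  ∃ l : ℝ, 1 ≤ l ∧ IsProjectiveConst (fun _ => True) l P

/-- `P` is a projective object of the category `pBL^(p)` of `p`-convex `p`-Banach lattices. -/
def IsProjectiveConvexPBL {p : ℝ} (hp : 0 < p) (P : PBanachLattice.{u} p) : Prop :=
  IsPConvex hp P ∧ ∃ l : ℝ, 1 ≤ l ∧ IsProjectiveConst (IsPConvex hp) l P

/-! ### Free `p`-Banach lattices -/

/-- `(F, δ)` is the free `p`-Banach lattice `FpBL[E]` generated by the `p`-Banach space `E`. -/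
def IsFreePBL {p : ℝ} {E : Type u} [AddCommGroup E] [Module ℝ E] [Norm E] [IsPBanach p E]
    (F : PBanachLattice.{u} p) (δ : E →ₗ[ℝ] F) : Prop :=
  (∀ e, ‖δ e‖ = ‖e‖) ∧
  ∀ (X : PBanachLattice.{u} p) (T : E →ₗ[ℝ] X), IsBoundedOp T →
    ∃ S : F →ₗ[ℝ] X, (IsLatticeHom S ∧ S ∘ₗ δ = T) ∧ opNorm S = opNorm T ∧
      ∀ S' : F →ₗ[ℝ] X, IsLatticeHom S' → S' ∘ₗ δ = T → S' = S

/-- `X` is (isomorphic to) a lattice-complemented sublattice of `F`: it embeds in `F` by a lattice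
homomorphism `α` whose range is the range of the lattice-homomorphic projection `α ∘ β`. -/
def IsLatticeComplemented {p : ℝ} (X F : PBanachLattice.{u} p) : Prop :=
  ∃ (α : X →ₗ[ℝ] F) (β : F →ₗ[ℝ] X), IsLatticeHom α ∧ IsLatticeHom β ∧ β ∘ₗ α = LinearMap.id

/-! ### The `p`-Banach lattice `ℓ_p(Γ)` -/

theorem memℓp_abs {Γ : Type u} {q : ℝ≥0∞} {f : Γ → ℝ} (hf : Memℓp f q) :
    Memℓp (fun i => |f i|) q := by
  rcases q.trichotomy with rfl | rfl | hq
  · refine memℓp_zero (hf.finite_dsupport.subset fun i hi => ?_)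
    simpa using hi
  · refine memℓp_infty ?_
    simpa using hf.bddAbove
  · refine memℓp_gen ?_
    simpa using hf.summable hq

theorem memℓp_sup {Γ : Type u} {q : ℝ≥0∞} {f g : Γ → ℝ} (hf : Memℓp f q) (hg : Memℓp g q) :
    Memℓp (fun i => f i ⊔ g i) q := by
  have h := ((hf.add hg).add (memℓp_abs (hf.sub hg))).const_smul (2⁻¹ : ℝ)
  convert h using 1
  funext i
  simp only [Pi.smul_apply, Pi.add_apply, Pi.sub_apply, smul_eq_mul]
  rw [max_def]
  split_ifs with h1
  · rw [abs_of_nonpos (by linarith)]; ring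
  · rw [abs_of_nonneg (by linarith)]; ring

theorem memℓp_inf {Γ : Type u} {q : ℝ≥0∞} {f g : Γ → ℝ} (hf : Memℓp f q) (hg : Memℓp g q) :
    Memℓp (fun i => f i ⊓ g i) q := by
  have h := (memℓp_sup hf.neg hg.neg).neg
  convert h using 1
  funext i
  simp [max_neg_neg]

/-- The coordinatewise order and lattice operations on `ℓ_q(Γ)`. -/
noncomputable instance lpLattice (Γ : Type u) (q : ℝ≥0∞) : Lattice (lp (fun _ : Γ => ℝ) q) where
  le f g := ∀ i, f i ≤ g i
  le_refl f i := le_rfl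
  le_trans f g h h1 h2 i := (h1 i).trans (h2 i)
  le_antisymm f g h1 h2 := lp.ext (funext fun i => le_antisymm (h1 i) (h2 i))
  sup f g := ⟨fun i => f i ⊔ g i, memℓp_sup (lp.memℓp f) (lp.memℓp g)⟩
  inf f g := ⟨fun i => f i ⊓ g i, memℓp_inf (lp.memℓp f) (lp.memℓp g)⟩
  le_sup_left f g i := le_max_left (f i) (g i)
  le_sup_right f g i := le_max_right (f i) (g i)
  sup_le f g h h1 h2 i := max_le (h1 i) (h2 i)
  inf_le_left f g i := min_le_left (f i) (g i)
  inf_le_right f g i := min_le_right (f i) (g i)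
  le_inf f g h h1 h2 i := le_min (h1 i) (h2 i)

theorem lp_norm_rpow {Γ : Type u} {p : ℝ} (hp : 0 < p)
    (f : lp (fun _ : Γ => ℝ) (ENNReal.ofReal p)) : ‖f‖ ^ p = ∑' i, |f i| ^ p := by
  have h : 0 < (ENNReal.ofReal p).toReal := by rwa [ENNReal.toReal_ofReal hp.le]
  simpa [ENNReal.toReal_ofReal hp.le] using lp.norm_rpow_eq_tsum h f

theorem lp_summable {Γ : Type u} {p : ℝ} (hp : 0 < p)
    (f : lp (fun _ : Γ => ℝ) (ENNReal.ofReal p)) : Summable fun i => |f i| ^ p := by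
  have h : 0 < (ENNReal.ofReal p).toReal := by rwa [ENNReal.toReal_ofReal hp.le]
  simpa [ENNReal.toReal_ofReal hp.le] using (lp.memℓp f).summable h

theorem lp_isPBanach {p : ℝ} (hp : 0 < p) (hp1 : p ≤ 1) (Γ : Type u) :
    IsPBanach p (lp (fun _ : Γ => ℝ) (ENNReal.ofReal p)) where
  norm_nonneg := lp.norm_nonneg'
  eq_zero_of_norm_eq_zero _ h := lp.norm_eq_zero_iff.1 h
  norm_smul c f := lp.norm_const_smul (by simpa using hp) f
  norm_add_rpow_le f g := by
    rw [lp_norm_rpow hp, lp_norm_rpow hp, lp_norm_rpow hp,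
      ← (lp_summable hp f).tsum_add (lp_summable hp g)]
    refine (lp_summable hp (f + g)).tsum_le_tsum (fun i => ?_)
      ((lp_summable hp f).add (lp_summable hp g))
    calc |(f + g) i| ^ p ≤ (|f i| + |g i|) ^ p :=
          Real.rpow_le_rpow (abs_nonneg _) (abs_add_le _ _) hp.le
      _ ≤ |f i| ^ p + |g i| ^ p :=
          Real.rpow_add_le_add_rpow (abs_nonneg _) (abs_nonneg _) hp.le hp1
  complete v hv := by
    have h0 : ENNReal.ofReal p ≠ 0 := by simpa using hp
    have hco : ∀ i, CauchySeq fun n => v n i := fun i => by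
      refine Metric.cauchySeq_iff.2 fun ε hε => ?_
      obtain ⟨N, hN⟩ := hv ε hε
      refine ⟨N, fun m hm n hn => ?_⟩
      rw [Real.dist_eq]
      exact (lp.norm_apply_le_norm h0 (v m - v n) i).trans_lt (hN m hm n hn)
    choose f hf using fun i => cauchySeq_tendsto_of_complete (hco i)
    have key : ∀ ε > 0, ∃ N, ∀ n ≥ N, ∀ s : Finset Γ, ∑ i ∈ s, |v n i - f i| ^ p ≤ ε ^ p := by
      intro ε hε
      obtain ⟨N, hN⟩ := hv ε hε
      refine ⟨N, fun n hn s => ?_⟩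
      have ht : Tendsto (fun m => ∑ i ∈ s, |v n i - v m i| ^ p) atTop
          (𝓝 (∑ i ∈ s, |v n i - f i| ^ p)) :=
        tendsto_finsetSum _ fun i _ =>
          (((tendsto_const_nhds.sub (hf i)).abs).rpow_const (Or.inr hp.le))
      refine le_of_tendsto ht (eventually_atTop.2 ⟨N, fun m hm => ?_⟩)
      calc ∑ i ∈ s, |v n i - v m i| ^ p ≤ ∑' i, |(v n - v m) i| ^ p :=
            (lp_summable hp (v n - v m)).sum_le_tsum s
              (fun i _ => Real.rpow_nonneg (abs_nonneg _) _)
        _ = ‖v n - v m‖ ^ p := (lp_norm_rpow hp _).symm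
        _ ≤ ε ^ p := Real.rpow_le_rpow (lp.norm_nonneg' _) (hN n hn m hm).le hp.le
    have hmem : ∀ n, (∃ C : ℝ, ∀ s : Finset Γ, ∑ i ∈ s, |v n i - f i| ^ p ≤ C) →
        Memℓp (fun i => v n i - f i) (ENNReal.ofReal p) := by
      rintro n ⟨C, hC⟩
      refine memℓp_gen' (C := C) fun s => ?_
      simpa [ENNReal.toReal_ofReal hp.le] using hC s
    obtain ⟨N, hN⟩ := key 1 one_pos
    have hfm : Memℓp f (ENNReal.ofReal p) := by
      have h := (lp.memℓp (v N)).sub (hmem N ⟨_, hN N le_rfl⟩)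
      convert h using 1
      funext i
      simp
    refine ⟨⟨f, hfm⟩, ?_⟩
    refine Metric.tendsto_atTop.2 fun ε hε => ?_
    obtain ⟨M, hM⟩ := key (ε / 2) (half_pos hε)
    refine ⟨M, fun n hn => ?_⟩
    have h1 : ‖v n - ⟨f, hfm⟩‖ ^ p ≤ (ε / 2) ^ p := by
      rw [lp_norm_rpow hp]
      exact (lp_summable hp _).tsum_le_of_sum_le fun s => hM n hn s
    have h2 : ‖v n - ⟨f, hfm⟩‖ ≤ ε / 2 :=
      (Real.rpow_le_rpow_iff (lp.norm_nonneg' _) (half_pos hε).le hp).1 h1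
    rw [Real.dist_eq, sub_zero, abs_of_nonneg (lp.norm_nonneg' _)]
    linarith

/-- The `p`-Banach lattice `ℓ_p(Γ)`, with its norm `(∑ |x_γ|ᵖ)^(1/p)` and coordinatewise order. -/
noncomputable def ellp {p : ℝ} (hp : 0 < p) (hp1 : p ≤ 1) (Γ : Type u) : PBanachLattice.{u} p :=
  letI := lp_isPBanach hp hp1 Γ
  { carrier := lp (fun _ : Γ => ℝ) (ENNReal.ofReal p)
    add_le_add := fun f g h hfg i => by simpa using hfg i
    smul_le_smul := fun c f g hc hfg i => mul_le_mul_of_nonneg_left (hfg i) hc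
    solid := fun f g hfg => by
      have h : ∀ i, |f i| ≤ |g i| := fun i => hfg i
      refine (Real.rpow_le_rpow_iff (lp.norm_nonneg' _) (lp.norm_nonneg' _) hp).1 ?_
      rw [lp_norm_rpow hp, lp_norm_rpow hp]
      exact (lp_summable hp f).tsum_le_tsum
        (fun i => Real.rpow_le_rpow (abs_nonneg _) (h i) hp.le) (lp_summable hp g) }

-- Countable implies projective. In a `p`-Banach lattice `‖·‖ᵖ` is subadditive, so every bounded
-- family is the image of the unit vectors `e_γ` under a bounded operator on `ℓ_p(Γ)`
-- (`ellp.exists_map_unit_eq`). Positive lifts of the vectors `T e_γ` along `π` therefore give a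
-- positive operator `R` with `π R = T`, but `R` need not preserve the lattice operations. With a
-- strictly positive `d ∈ ℓ_p(Γ)`, which exists when `Γ` is countable, put `b_γ = 2 d_γ e_γ - d`.
-- Then `b_γ⁺ = d_γ e_γ`, and the vectors `d_γ⁻¹ (R b_γ)⁺` are pairwise disjoint, still lift `T
-- e_γ`, and are dominated by `R e_γ`; sending `e_γ` to them is the required homomorphism.
--
-- Projective implies countable. Inside `C({0,1}^Γ) × ℓ_p(Γ)` the pairs `(f, a)` with `f(1_{γ}) =
-- a_γ` for all `γ` form a closed sublattice, and the second projection is a lattice quotient onto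
-- `ℓ_p(Γ)`. A homomorphic lift of the identity gives pairwise disjoint continuous functions `f_γ`
-- on the cube with `f_γ(1_{γ}) = 1`. Each `f_γ` is positive on a neighbourhood fixed by a finite
-- set `s_γ` of coordinates. If `γ ∉ s_γ'` and `γ' ∉ s_γ`, both functions are positive at
-- `1_{γ,γ'}`, a contradiction; and `countable_of_forall_mem_or_mem` shows that finite sets without
-- such a pair force `Γ` to be countable.
--
-- The lattices in this counterexample are `p`-convex with constant `1`, so both categories are
-- covered. For `ℓ_p(Γ)` and `C(K)` this is seen on the coordinate and evaluation functionals
-- through `abs_map_posHomLp_le`, and it passes to products and sublattices.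
--
-- The free lattice is the closed sublattice generated by the diagonal image of `E` in the product
-- over all contractions from `E` to `p`-Banach lattices. The extension of the identity of `ℓ_p(Γ)`
-- to the free lattice is a lattice quotient, which projectivity splits.

universe v w

/-! ### Operators between `p`-normed spaces -/

section OpNorm

variable {E F : Type*} [AddCommGroup E] [Module ℝ E] [Norm E] [AddCommGroup F] [Module ℝ F] [Norm F]

theorem opNorm_le_of_bound (p : ℝ) [IsPBanach p E] {T : E →ₗ[ℝ] F} {C : ℝ} (hC : 0 ≤ C)
    (h : ∀ x, ‖T x‖ ≤ C * ‖x‖) : opNorm T ≤ C := by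
  refine Real.sSup_le ?_ hC
  rintro _ ⟨x, hx, rfl⟩
  exact (h x).trans (mul_le_of_le_one_right hC hx)

theorem opNorm_nonneg (p : ℝ) [IsPBanach p F] (T : E →ₗ[ℝ] F) : 0 ≤ opNorm T := by
  refine Real.sSup_nonneg ?_
  rintro _ ⟨x, -, rfl⟩
  exact IsPBanach.norm_nonneg p _

theorem norm_le_opNorm_of_le_one {T : E →ₗ[ℝ] F} (p : ℝ) [IsPBanach p E]
    (hT : IsBoundedOp T) {x : E} (hx : ‖x‖ ≤ 1) : ‖T x‖ ≤ opNorm T := by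
  obtain ⟨C, hC⟩ := hT
  refine le_csSup ⟨|C|, ?_⟩ ⟨x, hx, rfl⟩
  rintro _ ⟨y, hy, rfl⟩
  have h0 : 0 ≤ ‖y‖ := IsPBanach.norm_nonneg p y
  calc ‖T y‖ ≤ C * ‖y‖ := hC y
    _ ≤ |C| * 1 := mul_le_mul (le_abs_self C) hy h0 (abs_nonneg C)
    _ = |C| := mul_one _

theorem norm_le_opNorm_mul (p : ℝ) [IsPBanach p E] [IsPBanach p F] {T : E →ₗ[ℝ] F}
    (hT : IsBoundedOp T) (x : E) : ‖T x‖ ≤ opNorm T * ‖x‖ := by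
  rcases (IsPBanach.norm_nonneg p x).eq_or_lt' with h | h
  · obtain ⟨C, hC⟩ := hT
    simpa [h] using hC x
  · have h1 : ‖(‖x‖⁻¹) • x‖ ≤ 1 := by
      rw [IsPBanach.norm_smul p, abs_of_pos (inv_pos.2 h), inv_mul_cancel₀ h.ne']
    have h2 := norm_le_opNorm_of_le_one p hT h1
    rw [map_smul, IsPBanach.norm_smul p, abs_of_pos (inv_pos.2 h), inv_mul_le_iff₀ h] at h2
    linarith

end OpNorm

/-! ### Vector lattices -/

section VectorLattice

variable {E F : Type*} [AddCommGroup E] [Module ℝ E] [Lattice E]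
    [AddCommGroup F] [Module ℝ F] [Lattice F]

theorem PreservesLattice.map_abs {T : E →ₗ[ℝ] F} (hT : PreservesLattice T) (x : E) :
    T |x| = |T x| := by
  rw [abs, abs, hT.1, map_neg]

theorem PreservesLattice.monotone {T : E →ₗ[ℝ] F} (hT : PreservesLattice T) : Monotone T := by
  intro x y h
  rw [← sup_eq_right, ← hT.1, sup_eq_right.2 h]

theorem PreservesLattice.comp {G : Type*} [AddCommGroup G] [Module ℝ G] [Lattice G]
    {S : F →ₗ[ℝ] G} {T : E →ₗ[ℝ] F} (hS : PreservesLattice S) (hT : PreservesLattice T) :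
    PreservesLattice (S ∘ₗ T) :=
  ⟨fun x y => by simp [hT.1, hS.1], fun x y => by simp [hT.2, hS.2]⟩

theorem preservesLattice_of_map_abs [IsOrderedAddMonoid E] [PosSMulMono ℝ E] [IsOrderedAddMonoid F]
    [PosSMulMono ℝ F] {T : E →ₗ[ℝ] F} (h : ∀ x, T |x| = |T x|) : PreservesLattice T := by
  refine ⟨fun x y => ?_, fun x y => ?_⟩
  · simp only [sup_eq_half_smul_add_add_abs_sub' ℝ, map_smul, map_add, h, map_sub]
  · simp only [inf_eq_half_smul_add_sub_abs_sub' ℝ, map_smul, map_add, h, map_sub]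

end VectorLattice

section LatticeGroup

variable {G : Type*} [AddCommGroup G] [Lattice G] [IsOrderedAddMonoid G]

theorem inf_add_le_of_nonneg {a b c : G} (ha : 0 ≤ a) (hb : 0 ≤ b) (hc : 0 ≤ c) :
    a ⊓ (b + c) ≤ a ⊓ b + a ⊓ c := by
  rw [inf_add, add_inf, add_inf]
  refine le_inf (le_inf ?_ ?_) (le_inf ?_ inf_le_right)
  · exact inf_le_left.trans (le_add_of_nonneg_left ha)
  · exact inf_le_left.trans (le_add_of_nonneg_right hc)
  · exact inf_le_left.trans (le_add_of_nonneg_left hb)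

theorem abs_inf_abs_add_eq_zero {a b c : G} (hb : |a| ⊓ |b| = 0) (hc : |a| ⊓ |c| = 0) :
    |a| ⊓ |b + c| = 0 := by
  refine le_antisymm ?_ (le_inf (abs_nonneg _) (abs_nonneg _))
  calc |a| ⊓ |b + c| ≤ |a| ⊓ (|b| + |c|) := inf_le_inf_left _ (abs_add_le _ _)
    _ ≤ |a| ⊓ |b| + |a| ⊓ |c| :=
      inf_add_le_of_nonneg (abs_nonneg _) (abs_nonneg _) (abs_nonneg _)
    _ = 0 := by rw [hb, hc, add_zero]

/-- Since `2 (|a| ⊓ |b|) = |a| + |b| - ||b| - |a||`, disjointness turns `|a| + |b|` into `||b| -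
|a||`, which is at most `|a + b|`. -/
theorem abs_add_eq_of_abs_inf_abs_eq_zero {a b : G} (h : |a| ⊓ |b| = 0) :
    |a + b| = |a| + |b| := by
  refine le_antisymm (abs_add_le _ _) ?_
  have h1 := two_nsmul_inf_eq_add_sub_abs_sub |a| |b|
  rw [h, smul_zero, eq_comm, sub_eq_zero] at h1
  rw [h1]
  have h2 := abs_abs_sub_abs_le b (-a)
  rwa [abs_neg, sub_neg_eq_add, add_comm b a] at h2

theorem abs_sum_eq_of_pairwise_abs_inf_abs_eq_zero {ι : Type*} {v : ι → G}
    (h : ∀ i j, i ≠ j → |v i| ⊓ |v j| = 0) (s : Finset ι) : |∑ i ∈ s, v i| = ∑ i ∈ s, |v i| := by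
  classical
  have hd : ∀ (s : Finset ι), ∀ i ∉ s, |v i| ⊓ |∑ j ∈ s, v j| = 0 := by
    intro s i hi
    induction s using Finset.induction_on with
    | empty => simp [abs_nonneg]
    | insert j s hj ih =>
      rw [Finset.mem_insert, not_or] at hi
      rw [Finset.sum_insert hj]
      exact abs_inf_abs_add_eq_zero (h _ _ hi.1) (ih hi.2)
  induction s using Finset.induction_on with
  | empty => simp
  | insert j s hj ih =>
    rw [Finset.sum_insert hj, Finset.sum_insert hj,
      abs_add_eq_of_abs_inf_abs_eq_zero (hd s j hj), ih]

theorem abs_smul_eq_abs_smul_abs [Module ℝ G] [PosSMulMono ℝ G] (c : ℝ) (x : G) :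
    |c • x| = |c| • |x| := by
  have key : ∀ (c : ℝ) (x : G), 0 ≤ c → |c • x| ≤ c • |x| := fun c x hc =>
    abs_le'.2 ⟨smul_le_smul_of_nonneg_left (le_abs_self x) hc, by
      rw [← smul_neg]; exact smul_le_smul_of_nonneg_left (neg_le_abs x) hc⟩
  have pos : ∀ (c : ℝ) (x : G), 0 ≤ c → |c • x| = c • |x| := by
    intro c x hc
    rcases hc.eq_or_lt' with rfl | h
    · simp
    refine le_antisymm (key c x hc) ?_
    -- The reverse inequality is `key` for `c⁻¹` and the vector `c • x`, rescaled by `c`.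
    have h1 := smul_le_smul_of_nonneg_left (key c⁻¹ (c • x) (inv_nonneg.2 hc)) hc
    rwa [smul_smul, smul_smul, inv_mul_cancel₀ h.ne', mul_inv_cancel₀ h.ne', one_smul,
      one_smul] at h1
  rcases le_total 0 c with hc | hc
  · rw [pos c x hc, abs_of_nonneg hc]
  · rw [← abs_neg, ← neg_smul, pos (-c) x (neg_nonneg.2 hc), abs_of_nonpos hc]

/-- The infimum lies below both `(c + d) • a` and `(c + d) • b`, hence below `(c + d) • (a ⊓ b)`
once `c + d` is positive. -/
theorem smul_inf_smul_eq_zero [Module ℝ G] [PosSMulMono ℝ G] {a b : G} {c d : ℝ} (hc : 0 ≤ c)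
    (hd : 0 ≤ d) (ha : 0 ≤ a) (hb : 0 ≤ b) (h : a ⊓ b = 0) : (c • a) ⊓ (d • b) = 0 := by
  refine le_antisymm ?_ (le_inf (smul_nonneg hc ha) (smul_nonneg hd hb))
  rcases (add_nonneg hc hd).eq_or_lt' with h1 | h1
  · rw [(by linarith : c = 0), zero_smul]
    exact inf_le_left
  · have h2 : (c • a) ⊓ (d • b) ≤ (c + d) • (a ⊓ b) := by
      rw [← inv_smul_le_iff_of_pos h1]
      refine le_inf ?_ ?_ <;> rw [inv_smul_le_iff_of_pos h1, add_smul]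
      · exact inf_le_left.trans (le_add_of_nonneg_right (smul_nonneg hd ha))
      · exact inf_le_right.trans (le_add_of_nonneg_left (smul_nonneg hc hb))
    rwa [h, smul_zero] at h2

end LatticeGroup

/-! ### The topology of a `p`-Banach lattice -/

namespace PBanachLattice

variable {p : ℝ}

instance (X : PBanachLattice.{u} p) : IsOrderedAddMonoid X where
  add_le_add_left x y h z := X.add_le_add x y z h

instance (X : PBanachLattice.{u} p) : PosSMulMono ℝ X :=
  ⟨fun c hc x y h => X.smul_le_smul c x y hc h⟩

protected theorem norm_nonneg (X : PBanachLattice.{u} p) (x : X) : 0 ≤ ‖x‖ :=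
  IsPBanach.norm_nonneg p x

protected theorem norm_smul (X : PBanachLattice.{u} p) (c : ℝ) (x : X) : ‖c • x‖ = |c| * ‖x‖ :=
  IsPBanach.norm_smul p c x

protected theorem norm_zero (X : PBanachLattice.{u} p) : ‖(0 : X)‖ = 0 := by
  simpa using X.norm_smul 0 0

protected theorem norm_neg (X : PBanachLattice.{u} p) (x : X) : ‖-x‖ = ‖x‖ := by
  simpa using X.norm_smul (-1) x

protected theorem norm_abs (X : PBanachLattice.{u} p) (x : X) : ‖|x|‖ = ‖x‖ :=
  le_antisymm (X.solid _ _ (by rw [abs_abs])) (X.solid _ _ (by rw [abs_abs]))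

variable [hp : Fact (0 < p)]

/-- `x ↦ ‖x‖ᵖ` as a group norm. -/
noncomputable def rpowNorm (X : PBanachLattice.{u} p) : AddGroupNorm X where
  toFun x := ‖x‖ ^ p
  map_zero' := by rw [X.norm_zero, Real.zero_rpow hp.out.ne']
  add_le' x y := IsPBanach.norm_add_rpow_le x y
  neg' x := by rw [X.norm_neg]
  eq_zero_of_map_eq_zero' x h := by
    refine IsPBanach.eq_zero_of_norm_eq_zero p x ?_
    exact (Real.rpow_eq_zero (X.norm_nonneg x) hp.out.ne').1 h

/-- The normed group structure given by `x ↦ ‖x‖ᵖ`. It is not an instance, since its norm is not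
the norm of `X`. -/
noncomputable abbrev rpowNormedGroup (X : PBanachLattice.{u} p) : NormedAddCommGroup X :=
  X.rpowNorm.toNormedAddCommGroup

/-- The distance is `‖x - y‖ᵖ`: for `p < 1` the `p`-norm itself need not satisfy the triangle
inequality. -/
noncomputable instance (X : PBanachLattice.{u} p) : MetricSpace X :=
  X.rpowNormedGroup.toMetricSpace

protected theorem dist_eq (X : PBanachLattice.{u} p) (x y : X) : dist x y = ‖x - y‖ ^ p := by
  let := X.rpowNormedGroup
  have : dist x y = X.rpowNorm (x - y) := by
    rw [dist_eq_norm]; rfl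
  exact this

instance (X : PBanachLattice.{u} p) : IsTopologicalAddGroup X :=
  letI := X.rpowNormedGroup
  inferInstance

instance (X : PBanachLattice.{u} p) : IsUniformAddGroup X :=
  letI := X.rpowNormedGroup
  inferInstance

theorem dist_lt_rpow_iff (X : PBanachLattice.{u} p) {x y : X} {ε : ℝ} (hε : 0 < ε) :
    dist x y < ε ^ p ↔ ‖x - y‖ < ε := by
  rw [X.dist_eq, Real.rpow_lt_rpow_iff (X.norm_nonneg _) hε.le hp.out]

theorem tendsto_iff {X : PBanachLattice.{u} p} {ι : Type*} {l : Filter ι} {v : ι → X} {x : X} :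
    Tendsto v l (𝓝 x) ↔ Tendsto (fun i => ‖v i - x‖) l (𝓝 0) := by
  simp only [Metric.tendsto_nhds, Real.dist_eq, sub_zero, abs_of_nonneg (X.norm_nonneg _)]
  refine ⟨fun h ε hε => ?_, fun h ε hε => ?_⟩
  · filter_upwards [h (ε ^ p) (Real.rpow_pos_of_pos hε p)] with i hi
    exact (X.dist_lt_rpow_iff hε).1 hi
  · filter_upwards [h (ε ^ p⁻¹) (Real.rpow_pos_of_pos hε _)] with i hi
    rw [← X.dist_lt_rpow_iff (Real.rpow_pos_of_pos hε _), ← Real.rpow_mul hε.le,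
      inv_mul_cancel₀ hp.out.ne', Real.rpow_one] at hi
    exact hi

instance (X : PBanachLattice.{u} p) : CompleteSpace X := by
  refine Metric.complete_of_cauchySeq_tendsto fun v hv => ?_
  obtain ⟨x, hx⟩ := IsPBanach.complete p v fun ε hε => by
    obtain ⟨N, hN⟩ := Metric.cauchySeq_iff.1 hv (ε ^ p) (Real.rpow_pos_of_pos hε p)
    exact ⟨N, fun m hm n hn => (X.dist_lt_rpow_iff hε).1 (hN m hm n hn)⟩
  exact ⟨x, tendsto_iff.2 hx⟩

/-- The gauges `d` and `e` are left abstract so that one argument serves operators between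
`p`-Banach lattices, real functionals and the nonlinear map `|·|`. -/
theorem continuous_of_norm_sub_le {X Y : Type*} [TopologicalSpace X] [TopologicalSpace Y]
    {f : X → Y} (d : X → X → ℝ) (e : Y → Y → ℝ) (C : ℝ)
    (hd : ∀ x, Tendsto (fun y => d y x) (𝓝 x) (𝓝 0))
    (he : ∀ x, Tendsto (fun y => e (f y) (f x)) (𝓝 x) (𝓝 0) → Tendsto f (𝓝 x) (𝓝 (f x)))
    (h0 : ∀ x y, 0 ≤ e x y) (h : ∀ x y, e (f x) (f y) ≤ C * d x y) : Continuous f := by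
  refine continuous_iff_continuousAt.2 fun x => he x ?_
  refine squeeze_zero (fun y => h0 _ _) (fun y => h y x) ?_
  simpa using (hd x).const_mul C

theorem tendsto_norm_sub_self (X : PBanachLattice.{u} p) (x : X) :
    Tendsto (fun y => ‖y - x‖) (𝓝 x) (𝓝 0) :=
  tendsto_iff.1 tendsto_id

theorem continuous_of_bound {X : PBanachLattice.{u} p} {Y : PBanachLattice.{v} p} {T : X →ₗ[ℝ] Y}
    {C : ℝ} (h : ∀ x, ‖T x‖ ≤ C * ‖x‖) : Continuous T :=
  continuous_of_norm_sub_le (fun x y => ‖x - y‖) (fun x y => ‖x - y‖) C X.tendsto_norm_sub_self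
    (fun _ => tendsto_iff.2) (fun _ _ => Y.norm_nonneg _) fun x y => by
      rw [← map_sub]; exact h _

theorem continuous_real_of_bound {X : PBanachLattice.{u} p} {T : X →ₗ[ℝ] ℝ}
    {C : ℝ} (h : ∀ x, |T x| ≤ C * ‖x‖) : Continuous T :=
  continuous_of_norm_sub_le (fun x y => ‖x - y‖) (fun x y => |x - y|) C X.tendsto_norm_sub_self
    (fun x hx => tendsto_iff_dist_tendsto_zero.2 hx) (fun _ _ => abs_nonneg _) fun x y => by
      rw [← map_sub]; exact h _

instance (X : PBanachLattice.{u} p) : ContinuousConstSMul ℝ X where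
  continuous_const_smul c :=
    continuous_of_bound (T := c • (LinearMap.id : X →ₗ[ℝ] X)) (C := |c|) fun x =>
      (X.norm_smul c x).le

protected theorem continuous_abs (X : PBanachLattice.{u} p) : Continuous fun x : X => |x| :=
  continuous_of_norm_sub_le (fun x y => ‖x - y‖) (fun x y => ‖x - y‖) 1 X.tendsto_norm_sub_self
    (fun _ => tendsto_iff.2) (fun _ _ => X.norm_nonneg _) fun x y => by
      rw [one_mul]; exact X.solid _ _ (abs_abs_sub_abs_le x y)

protected theorem continuous_norm (X : PBanachLattice.{u} p) : Continuous fun x : X => ‖x‖ := by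
  have h : Continuous fun x : X => (dist x 0) ^ p⁻¹ :=
    (continuous_id.dist continuous_const).rpow_const fun _ => Or.inr (inv_nonneg.2 hp.out.le)
  convert h using 2 with x
  rw [X.dist_eq, sub_zero, ← Real.rpow_mul (X.norm_nonneg x), mul_inv_cancel₀ hp.out.ne',
    Real.rpow_one]

theorem isClosed_nonneg (X : PBanachLattice.{u} p) : IsClosed {x : X | 0 ≤ x} := by
  have : {x : X | 0 ≤ x} = {x : X | |x| = x} := by
    ext x
    exact ⟨fun h => abs_of_nonneg h, fun h => h ▸ abs_nonneg x⟩
  rw [this]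
  exact isClosed_eq X.continuous_abs continuous_id

end PBanachLattice

theorem IsBoundedOp.continuous {p : ℝ} [Fact (0 < p)] {X : PBanachLattice.{u} p}
    {Y : PBanachLattice.{v} p} {T : X →ₗ[ℝ] Y} (h : IsBoundedOp T) : Continuous T :=
  PBanachLattice.continuous_of_bound h.choose_spec

namespace PBanachLattice

variable {p : ℝ} [hp : Fact (0 < p)]

theorem summable_of_summable_norm_rpow {X : PBanachLattice.{u} p} {ι : Type*} {f : ι → X}
    (h : Summable fun i => ‖f i‖ ^ p) : Summable f := by
  let := X.rpowNormedGroup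
  exact Summable.of_norm h

theorem norm_tsum_rpow_le {X : PBanachLattice.{u} p} {ι : Type*} {f : ι → X}
    (h : Summable fun i => ‖f i‖ ^ p) : ‖∑' i, f i‖ ^ p ≤ ∑' i, ‖f i‖ ^ p := by
  have hf := (summable_of_summable_norm_rpow h).hasSum
  have hc : Continuous fun x : X => ‖x‖ ^ p :=
    X.continuous_norm.rpow_const fun _ => Or.inr hp.out.le
  refine le_of_tendsto ((hc.tendsto _).comp hf) (Eventually.of_forall fun s => ?_)
  refine le_trans ?_ (h.sum_le_tsum s fun i _ => Real.rpow_nonneg (X.norm_nonneg _) _)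
  exact Finset.le_sum_of_subadditive (fun x : X => ‖x‖ ^ p) X.rpowNorm.map_zero'.le
    X.rpowNorm.add_le' s f

end PBanachLattice

/-! ### Coordinates and unit vectors of `ℓ_p(Γ)` -/

namespace ellp

variable {p : ℝ} {hp : 0 < p} {hp1 : p ≤ 1} {Γ : Type u}

/-- The coordinate functionals of `ℓ_p(Γ)`. -/
noncomputable def coord (γ : Γ) : ellp hp hp1 Γ →ₗ[ℝ] ℝ where
  toFun a := (show lp (fun _ : Γ => ℝ) (ENNReal.ofReal p) from a) γ
  map_add' _ _ := rfl
  map_smul' _ _ := rfl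

theorem ext {a b : ellp hp hp1 Γ} (h : ∀ γ, coord γ a = coord γ b) : a = b :=
  lp.ext (funext h)

theorem norm_rpow (a : ellp hp hp1 Γ) : ‖a‖ ^ p = ∑' γ, |coord γ a| ^ p :=
  lp_norm_rpow hp _

theorem summable_coord_rpow (a : ellp hp hp1 Γ) : Summable fun γ => |coord γ a| ^ p :=
  lp_summable hp _

theorem preservesLattice_coord (γ : Γ) : PreservesLattice (coord γ : ellp hp hp1 Γ →ₗ[ℝ] ℝ) :=
  ⟨fun _ _ => rfl, fun _ _ => rfl⟩

theorem le_iff {a b : ellp hp hp1 Γ} : a ≤ b ↔ ∀ γ, coord γ a ≤ coord γ b :=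
  Iff.rfl

theorem exists_coord_eq {f : Γ → ℝ} (h : Summable fun γ => |f γ| ^ p) :
    ∃ a : ellp hp hp1 Γ, ∀ γ, coord γ a = f γ :=
  ⟨(⟨f, memℓp_gen (by simpa [ENNReal.toReal_ofReal hp.le] using h)⟩ :
    lp (fun _ : Γ => ℝ) (ENNReal.ofReal p)), fun _ => rfl⟩

theorem abs_coord_le_norm (γ : Γ) (a : ellp hp hp1 Γ) : |coord γ a| ≤ ‖a‖ :=
  lp.norm_apply_le_norm (by simpa using hp) (show lp (fun _ : Γ => ℝ) (ENNReal.ofReal p) from a) γ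

open Classical in
/-- The unit vectors of `ℓ_p(Γ)`. -/
noncomputable def unit (γ : Γ) : ellp hp hp1 Γ :=
  lp.single (E := fun _ : Γ => ℝ) (ENNReal.ofReal p) γ 1

open Classical in
theorem coord_unit (γ γ' : Γ) :
    coord γ (unit γ' : ellp hp hp1 Γ) = if γ = γ' then 1 else 0 := by
  refine (lp.single_apply (E := fun _ : Γ => ℝ) (ENNReal.ofReal p) γ' 1 γ).trans ?_
  rw [Pi.single_apply]

@[simp]
theorem coord_unit_self (γ : Γ) : coord γ (unit γ : ellp hp hp1 Γ) = 1 := by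
  rw [coord_unit, if_pos rfl]

theorem coord_unit_of_ne {γ γ' : Γ} (h : γ ≠ γ') : coord γ (unit γ' : ellp hp hp1 Γ) = 0 := by
  rw [coord_unit, if_neg h]

theorem norm_unit (γ : Γ) : ‖(unit γ : ellp hp hp1 Γ)‖ = 1 := by
  classical
  refine (lp.norm_single (E := fun _ : Γ => ℝ) (by simpa using hp) γ 1).trans ?_
  simp

theorem unit_nonneg (γ : Γ) : (0 : ellp hp hp1 Γ) ≤ unit γ := by
  classical
  refine le_iff.2 fun γ' => ?_
  rw [map_zero, coord_unit]
  split_ifs <;> norm_num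

theorem coord_sum_smul_unit [DecidableEq Γ] (s : Finset Γ) (f : Γ → ℝ) (γ : Γ) :
    coord γ (∑ i ∈ s, f i • (unit i : ellp hp hp1 Γ)) = if γ ∈ s then f γ else 0 := by
  rw [map_sum]
  simp only [map_smul, coord_unit, smul_eq_mul, mul_ite, mul_one, mul_zero]
  convert Finset.sum_ite_eq s γ f

variable [Fact (0 < p)]

/-- In the metric `‖x - y‖ᵖ` the distance from `a` to a finite partial sum is exactly the tail of
the convergent series `∑ |a_γ|ᵖ`. -/
theorem hasSum_coord_smul_unit (a : ellp hp hp1 Γ) : HasSum (fun γ => coord γ a • unit γ) a := by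
  classical
  refine tendsto_iff_dist_tendsto_zero.2 ?_
  have key : ∀ s : Finset Γ, dist (∑ γ ∈ s, coord γ a • unit γ) a =
      ∑' γ, |coord γ a| ^ p - ∑ γ ∈ s, |coord γ a| ^ p := by
    intro s
    have h1 : HasSum (fun γ => if γ ∈ s then |coord γ a| ^ p else 0)
        (∑ γ ∈ s, |coord γ a| ^ p) := by
      rw [← Finset.sum_congr rfl fun γ (h : γ ∈ s) => if_pos h]
      exact hasSum_sum_of_ne_finset_zero fun γ h => if_neg h
    rw [PBanachLattice.dist_eq, norm_rpow,
      ← HasSum.tsum_eq ((summable_coord_rpow a).hasSum.sub h1)]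
    refine tsum_congr fun γ => ?_
    rw [map_sub, coord_sum_smul_unit]
    split_ifs
    · simp [Real.zero_rpow hp.ne']
    · simp
  simp only [key]
  have h := (summable_coord_rpow a).hasSum.const_sub (∑' γ, |coord γ a| ^ p)
  rwa [sub_self] at h

theorem continuous_coord (γ : Γ) : Continuous (coord γ : ellp hp hp1 Γ →ₗ[ℝ] ℝ) :=
  PBanachLattice.continuous_real_of_bound (C := 1) fun a => by
    rw [one_mul]; exact abs_coord_le_norm γ a

theorem linearMap_ext {M : Type*} [AddCommGroup M] [Module ℝ M] [TopologicalSpace M] [T2Space M]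
    {S T : ellp hp hp1 Γ →ₗ[ℝ] M} (hS : Continuous S) (hT : Continuous T)
    (h : ∀ γ, S (unit γ) = T (unit γ)) : S = T := by
  ext a
  have h1 := (hasSum_coord_smul_unit a).map S.toAddMonoidHom hS
  have h2 := (hasSum_coord_smul_unit a).map T.toAddMonoidHom hT
  refine h1.unique ?_
  have h3 : (fun γ => S (coord γ a • unit γ)) = fun γ => T (coord γ a • unit γ) := by
    funext γ
    rw [map_smul, map_smul, h]
  exact (congrArg (fun f => HasSum f (T a)) h3).mpr h2

/-- A bounded family in `X` is the image of the unit vectors under a bounded operator. -/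
theorem exists_map_unit_eq {X : PBanachLattice.{v} p} (y : Γ → X) {C : ℝ} (hC : 0 ≤ C)
    (hy : ∀ γ, ‖y γ‖ ≤ C) :
    ∃ R : ellp hp hp1 Γ →ₗ[ℝ] X, (∀ γ, R (unit γ) = y γ) ∧ ∀ a, ‖R a‖ ≤ C * ‖a‖ := by
  classical
  -- Because `‖·‖ᵖ` is subadditive in `X`, this termwise bound gives both the convergence of `∑ a_γ
  -- y_γ` and the norm estimate.
  have hle : ∀ (a : ellp hp hp1 Γ) (γ : Γ), ‖coord γ a • y γ‖ ^ p ≤ C ^ p * |coord γ a| ^ p := by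
    intro a γ
    rw [← Real.mul_rpow hC (abs_nonneg _), X.norm_smul, mul_comm]
    exact Real.rpow_le_rpow (mul_nonneg (X.norm_nonneg _) (abs_nonneg _))
      (mul_le_mul_of_nonneg_right (hy γ) (abs_nonneg _)) hp.le
  have hs : ∀ a : ellp hp hp1 Γ, Summable fun γ => ‖coord γ a • y γ‖ ^ p := fun a =>
    Summable.of_nonneg_of_le (fun γ => Real.rpow_nonneg (X.norm_nonneg _) _) (hle a)
      ((summable_coord_rpow a).mul_left _)
  have hs' : ∀ a : ellp hp hp1 Γ, Summable fun γ => coord γ a • y γ := fun a =>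
    PBanachLattice.summable_of_summable_norm_rpow (hs a)
  refine ⟨{ toFun := fun a => ∑' γ, coord γ a • y γ
            map_add' := fun a b => ?_
            map_smul' := fun c a => ?_ }, fun γ => ?_, fun a => ?_⟩
  · simp only [map_add, add_smul]
    exact (hs' a).tsum_add (hs' b)
  · simp only [map_smul, smul_eq_mul, mul_smul, RingHom.id_apply]
    exact (hs' a).tsum_const_smul c
  · change ∑' γ', coord γ' (unit γ : ellp hp hp1 Γ) • y γ' = y γ
    rw [tsum_eq_single γ fun γ' h => by rw [coord_unit_of_ne h, zero_smul], coord_unit_self,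
      one_smul]
  · refine (Real.rpow_le_rpow_iff (X.norm_nonneg _)
      (mul_nonneg hC (PBanachLattice.norm_nonneg _ a)) hp).1 ?_
    rw [Real.mul_rpow hC (PBanachLattice.norm_nonneg _ a), norm_rpow, ← tsum_mul_left]
    exact (PBanachLattice.norm_tsum_rpow_le (hs a)).trans
      ((hs a).tsum_le_tsum (hle a) ((summable_coord_rpow a).mul_left _))

theorem map_nonneg {X : PBanachLattice.{v} p} {R : ellp hp hp1 Γ →ₗ[ℝ] X} (hR : Continuous R)
    (h : ∀ γ, 0 ≤ R (unit γ)) {a : ellp hp hp1 Γ} (ha : 0 ≤ a) : 0 ≤ R a := by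
  have h1 := (hasSum_coord_smul_unit a).map R.toAddMonoidHom hR
  refine X.isClosed_nonneg.mem_of_tendsto h1 (Eventually.of_forall fun s => ?_)
  refine Finset.sum_nonneg fun γ _ => ?_
  have h2 : 0 ≤ coord γ a := by simpa using le_iff.1 ha γ
  simpa using smul_nonneg h2 (h γ)

/-- On finite sums of disjoint vectors the absolute value is additive; continuity carries `R |a| =
|R a|` to the limit, and the lattice operations are linear expressions in absolute values. -/
theorem preservesLattice_of_disjoint {X : PBanachLattice.{v} p} {R : ellp hp hp1 Γ →ₗ[ℝ] X}
    (hR : Continuous R) (h0 : ∀ γ, 0 ≤ R (unit γ))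
    (h : ∀ γ γ', γ ≠ γ' → R (unit γ) ⊓ R (unit γ') = 0) : PreservesLattice R := by
  classical
  have disj : ∀ (c d : ℝ) (γ γ' : Γ), γ ≠ γ' →
      |c • R (unit γ)| ⊓ |d • R (unit γ')| = 0 := by
    intro c d γ γ' hne
    rw [abs_smul_eq_abs_smul_abs, abs_smul_eq_abs_smul_abs, abs_of_nonneg (h0 γ),
      abs_of_nonneg (h0 γ')]
    exact smul_inf_smul_eq_zero (abs_nonneg _) (abs_nonneg _) (h0 _) (h0 _) (h γ γ' hne)
  have fin : ∀ (f : Γ → ℝ) (s : Finset Γ),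
      |∑ γ ∈ s, f γ • R (unit γ)| = ∑ γ ∈ s, |f γ| • R (unit γ) := by
    intro f s
    rw [abs_sum_eq_of_pairwise_abs_inf_abs_eq_zero fun i j hij => disj (f i) (f j) i j hij]
    exact Finset.sum_congr rfl fun γ _ => by
      rw [abs_smul_eq_abs_smul_abs, abs_of_nonneg (h0 γ)]
  refine preservesLattice_of_map_abs fun a => ?_
  have h1 := (hasSum_coord_smul_unit a).map R.toAddMonoidHom hR
  have h2 := (hasSum_coord_smul_unit |a|).map R.toAddMonoidHom hR
  refine tendsto_nhds_unique h2 ?_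
  refine ((X.continuous_abs.tendsto _).comp h1).congr fun s => ?_
  simp only [Function.comp, LinearMap.toAddMonoidHom_coe, map_smul]
  rw [fin]
  exact Finset.sum_congr rfl fun γ _ => by rw [(preservesLattice_coord γ).map_abs]

end ellp

/-! ### Projectivity for countable index sets -/

namespace ellp

variable {p : ℝ} {hp : 0 < p} {hp1 : p ≤ 1} {Γ : Type u}

/-- There is a strictly positive element of `ℓ_p(Γ)` when `Γ` is countable. -/
theorem exists_coord_pos [Countable Γ] : ∃ d : ellp hp hp1 Γ, ∀ γ, 0 < coord γ d := by
  -- Positive summable weights exist because `Γ` is countable; their `1/p`-th powers are the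
  -- coordinates of `d`.
  obtain ⟨ε, hε, c, hc, -⟩ := (Set.to_countable (Set.univ : Set Γ)).exists_pos_hasSum_le one_pos
  have hs : Summable ε :=
    (Equiv.Set.univ Γ).summable_iff.1 (hc.summable.congr fun _ => rfl)
  obtain ⟨d, h⟩ := exists_coord_eq (hp := hp) (hp1 := hp1) (f := fun γ => ε γ ^ p⁻¹) <| by
    refine hs.congr fun γ => ?_
    rw [abs_of_pos (Real.rpow_pos_of_pos (hε γ) _), ← Real.rpow_mul (hε γ).le,
      inv_mul_cancel₀ hp.ne', Real.rpow_one]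
  exact ⟨d, fun γ => (h γ).symm ▸ Real.rpow_pos_of_pos (hε γ) _⟩

/-- The infimum defining the quotient norm need not be attained, so some factor above `1` is spent;
`2` is an arbitrary choice. Replacing a lift by its absolute value makes it positive without
changing its norm. The case `‖z‖ = 0` is separate because there `‖z‖ < 2 * ‖z‖` fails. -/
theorem exists_nonneg_lift {p : ℝ} {X Z : PBanachLattice.{u} p} {π : X →ₗ[ℝ] Z}
    (hπ : IsLatticeQuotient π) {z : Z} (hz : 0 ≤ z) :
    ∃ y : X, 0 ≤ y ∧ π y = z ∧ ‖y‖ ≤ 2 * ‖z‖ := by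
  obtain ⟨⟨hl, -⟩, -, hglb⟩ := hπ
  rcases (Z.norm_nonneg z).eq_or_lt' with h | h
  · refine ⟨0, le_rfl, ?_, by rw [X.norm_zero, h, mul_zero]⟩
    rw [map_zero, IsPBanach.eq_zero_of_norm_eq_zero p z h]
  · obtain ⟨_, ⟨x, hx, rfl⟩, hlt⟩ := (isGLB_lt_iff (hglb z)).1 (by linarith : ‖z‖ < 2 * ‖z‖)
    refine ⟨|x|, abs_nonneg x, ?_, ?_⟩
    · rw [hl.map_abs, hx, abs_of_nonneg hz]
    · rw [X.norm_abs]; exact hlt.le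

/-- The lift is built inside the given `X` alone, so the class `𝒞` can be arbitrary and both
categories are served at once. -/
theorem isProjectiveConst_of_countable [Countable Γ] (𝒞 : PBanachLattice.{u} p → Prop) :
    IsProjectiveConst 𝒞 2 (ellp hp hp1 Γ) := by
  intro X Z _ _ π hπ T hT
  have : Fact (0 < p) := ⟨hp⟩
  have hTu : ∀ γ, 0 ≤ T (unit γ) := fun γ => by
    simpa using hT.1.monotone (unit_nonneg γ)
  choose y hy0 hyT hyn using fun γ => exists_nonneg_lift hπ (hTu γ)
  have hC : 0 ≤ 2 * opNorm T := mul_nonneg zero_le_two (opNorm_nonneg p T)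
  have hyC : ∀ γ, ‖y γ‖ ≤ 2 * opNorm T := fun γ =>
    (hyn γ).trans (mul_le_mul_of_nonneg_left
      (norm_le_opNorm_of_le_one p hT.2 (norm_unit γ).le) zero_le_two)
  obtain ⟨R, hRu, hRb⟩ := exists_map_unit_eq (hp := hp) (hp1 := hp1) y hC hyC
  have hRc : Continuous R := PBanachLattice.continuous_of_bound hRb
  have hRT : π ∘ₗ R = T :=
    linearMap_ext (hπ.1.2.continuous.comp hRc) hT.2.continuous fun γ => by
      rw [LinearMap.comp_apply, hRu, hyT]
  have hR0 : ∀ {a}, 0 ≤ a → 0 ≤ R a := fun ha =>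
    map_nonneg hRc (fun γ => (hRu γ).symm ▸ hy0 γ) ha
  have hRm : ∀ {a b}, a ≤ b → R a ≤ R b := fun {a b} h => by
    have := hR0 (sub_nonneg.2 h)
    rwa [map_sub, sub_nonneg] at this
  obtain ⟨d, hd⟩ := exists_coord_pos (hp := hp) (hp1 := hp1) (Γ := Γ)
  -- `b γ` equals `d_γ` at `γ` and `-d_i` at every other `i`. Its positive part is thus a multiple
  -- of `unit γ`, while its negative part is what separates different indices after applying `R`.
  set b : Γ → ellp hp hp1 Γ := fun γ => (2 * coord γ d) • unit γ - d with hb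
  have hb1 : ∀ γ, b γ ⊔ 0 = coord γ d • unit γ := by
    intro γ
    refine ext fun i => ?_
    rw [(preservesLattice_coord i).1, hb, map_zero, map_sub, map_smul, map_smul]
    rcases eq_or_ne i γ with rfl | hi
    · rw [coord_unit_self, smul_eq_mul, smul_eq_mul, mul_one, mul_one, two_mul,
        add_sub_cancel_right]
      exact sup_eq_left.2 (hd i).le
    · rw [coord_unit_of_ne hi, smul_zero, smul_zero, zero_sub]
      exact sup_eq_right.2 (neg_nonpos.2 (hd i).le)
  have hb2 : ∀ γ γ', γ ≠ γ' → b γ ≤ coord γ d • unit γ - coord γ' d • unit γ' := by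
    intro γ γ' hne
    refine le_iff.2 fun i => ?_
    simp only [hb, map_sub, map_smul, smul_eq_mul]
    rcases eq_or_ne i γ with rfl | hi
    · rw [coord_unit_self, coord_unit_of_ne hne]; linarith
    · rw [coord_unit_of_ne hi]
      rcases eq_or_ne i γ' with rfl | hi'
      · rw [coord_unit_self]; linarith
      · rw [coord_unit_of_ne hi']; linarith [hd i]
  set x : Γ → X := fun γ => (coord γ d)⁻¹ • (R (b γ) ⊔ 0) with hx
  have hdi : ∀ γ, 0 ≤ (coord γ d)⁻¹ := fun γ => (inv_pos.2 (hd γ)).le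
  have hx0 : ∀ γ, 0 ≤ x γ := fun γ => smul_nonneg (hdi γ) le_sup_right
  have hxy : ∀ γ, x γ ≤ y γ := by
    intro γ
    rw [hx, inv_smul_le_iff_of_pos (hd γ), ← hRu, ← map_smul, ← hb1]
    exact sup_le (hRm le_sup_left) (hR0 le_sup_right)
  have hxC : ∀ γ, ‖x γ‖ ≤ 2 * opNorm T := fun γ =>
    (X.solid _ _ (by rw [abs_of_nonneg (hx0 γ), abs_of_nonneg (hy0 γ)]; exact hxy γ)).trans (hyC γ)
  have hxd : ∀ γ γ', γ ≠ γ' → x γ ⊓ x γ' = 0 := by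
    intro γ γ' hne
    refine smul_inf_smul_eq_zero (hdi γ) (hdi γ') le_sup_right le_sup_right ?_
    refine le_antisymm ?_ (le_inf le_sup_right le_sup_right)
    -- With `u = R (d_γ e_γ - d_γ' e_γ')` one has `R (b γ) ≤ u` and `R (b γ') ≤ -u`, so the two
    -- positive parts lie below the disjoint elements `u⁺` and `u⁻`.
    have h1 := hRm (hb2 γ γ' hne)
    have h2 := hRm (hb2 γ' γ hne.symm)
    rw [← neg_sub, map_neg] at h2
    exact (inf_le_inf (sup_le_sup_right h1 0) (sup_le_sup_right h2 0)).trans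
      (posPart_inf_negPart_eq_zero (R (coord γ d • unit γ - coord γ' d • unit γ'))).le
  obtain ⟨S, hSu, hSb⟩ := exists_map_unit_eq (hp := hp) (hp1 := hp1) x hC hxC
  have hSc : Continuous S := PBanachLattice.continuous_of_bound hSb
  refine ⟨S, ⟨preservesLattice_of_disjoint hSc (fun γ => ?_) fun γ γ' hne => ?_, _, hSb⟩, ?_,
    opNorm_le_of_bound p hC hSb⟩
  · rw [hSu]; exact hx0 γ
  · rw [hSu, hSu]; exact hxd γ γ' hne
  · refine linearMap_ext (hπ.1.2.continuous.comp hSc) hT.2.continuous fun γ => ?_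
    -- Since `π` and `T` preserve suprema, `π (R b_γ)⁺ = (T b_γ)⁺ = T (b_γ⁺) = d_γ T e_γ`.
    rw [LinearMap.comp_apply, hSu, hx]
    have h1 : π (R (b γ)) = T (b γ) := LinearMap.congr_fun hRT _
    rw [map_smul, hπ.1.1.1, h1, map_zero, ← map_zero T, ← hT.1.1, hb1, map_smul, smul_smul,
      inv_mul_cancel₀ (hd γ).ne', one_smul]

end ellp

/-! ### `p`-convexity -/

/-- The tangent hyperplane inequality for the concave function `b ↦ (∑ b_kᵖ)^(1/p)`, `0 < p < 1`. -/
theorem rpow_sum_rpow_le_tangent {p : ℝ} (hp : 0 < p) (hp1 : p < 1) {n : ℕ} {a b : Fin n → ℝ}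
    (ha : ∀ k, 0 < a k) (hb : ∀ k, 0 ≤ b k) :
    (∑ k, b k ^ p) ^ (1 / p) ≤ (∑ k, a k ^ p) ^ (1 / p - 1) * ∑ k, a k ^ (p - 1) * b k := by
  have hq : 0 < 1 - p := sub_pos.2 hp1
  have hA : 0 ≤ ∑ k, a k ^ p := Finset.sum_nonneg fun k _ => (Real.rpow_pos_of_pos (ha k) p).le
  have hm : ∀ k, 0 ≤ a k ^ (p - 1) * b k := fun k =>
    mul_nonneg (Real.rpow_pos_of_pos (ha k) _).le (hb k)
  have hB : 0 ≤ ∑ k, a k ^ (p - 1) * b k := Finset.sum_nonneg fun k _ => hm k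
  have hconj : (1 / p).HolderConjugate (1 / (1 - p)) := by
    rw [Real.holderConjugate_iff]
    refine ⟨by rw [lt_div_iff₀ hp]; linarith, by field_simp; ring⟩
  -- Hölder's inequality with exponents `1/p` and `1/(1-p)` for the splitting `bᵖ = (a^(p-1) b)ᵖ ·
  -- a^(p(1-p))`.
  have hold := Real.inner_le_Lp_mul_Lq_of_nonneg Finset.univ hconj
    (f := fun k => (a k ^ (p - 1) * b k) ^ p) (g := fun k => a k ^ (p * (1 - p)))
    (fun k _ => Real.rpow_nonneg (hm k) _) (fun k _ => (Real.rpow_pos_of_pos (ha k) _).le)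
  have e1 : ∀ k, (a k ^ (p - 1) * b k) ^ p * a k ^ (p * (1 - p)) = b k ^ p := fun k => by
    rw [Real.mul_rpow (Real.rpow_pos_of_pos (ha k) _).le (hb k), ← Real.rpow_mul (ha k).le,
      mul_right_comm, ← Real.rpow_add (ha k)]
    rw [show (p - 1) * p + p * (1 - p) = 0 by ring, Real.rpow_zero, one_mul]
  have e2 : ∀ k, ((a k ^ (p - 1) * b k) ^ p) ^ (1 / p) = a k ^ (p - 1) * b k := fun k => by
    rw [← Real.rpow_mul (hm k), mul_one_div_cancel hp.ne', Real.rpow_one]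
  have e3 : ∀ k, (a k ^ (p * (1 - p))) ^ (1 / (1 - p)) = a k ^ p := fun k => by
    rw [← Real.rpow_mul (ha k).le, mul_assoc, mul_one_div_cancel hq.ne', mul_one]
  simp only [e1, e2, e3, one_div_one_div] at hold
  refine (Real.rpow_le_rpow (Finset.sum_nonneg fun k _ => Real.rpow_nonneg (hb k) _) hold
    (one_div_nonneg.2 hp.le)).trans_eq ?_
  rw [Real.mul_rpow (Real.rpow_nonneg hB _) (Real.rpow_nonneg hA _), ← Real.rpow_mul hB,
    ← Real.rpow_mul hA, mul_one_div_cancel hp.ne', Real.rpow_one, mul_comm]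
  congr 2
  field_simp

/-- A real lattice homomorphism on `H_n` is dominated by an evaluation on `(∑ |a_k|ᵖ)^(1/p)`. -/
theorem abs_map_posHomLp_le {p : ℝ} (hp : 0 < p) (hp1 : p < 1) {n : ℕ} {φ : posHom n →ₗ[ℝ] ℝ}
    (hφ : PreservesLattice φ) :
    |φ (posHomLp hp n)| ≤ (∑ k, |φ (posHomCoord k)| ^ p) ^ (1 / p) := by
  have hnn : 0 ≤ φ (posHomLp hp n) := by
    have h : (0 : posHom n) ≤ posHomLp hp n := fun a =>
      Real.rpow_nonneg (Finset.sum_nonneg fun k _ => Real.rpow_nonneg (abs_nonneg _) _) _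
    simpa using hφ.monotone h
  rw [abs_of_nonneg hnn]
  -- The tangent is taken at `|φ(x_k)| + ε`, where `x_k` is the `k`-th coordinate function: the
  -- shift keeps the base point positive, as the negative power `a^(p-1)` requires, and is removed
  -- by `ε → 0`.
  have key : ∀ ε > 0, φ (posHomLp hp n) ≤ (∑ k, (|φ (posHomCoord k)| + ε) ^ p) ^ (1 / p) := by
    intro ε hε
    set a : Fin n → ℝ := fun k => |φ (posHomCoord k)| + ε with ha
    have ha0 : ∀ k, 0 < a k := fun k => add_pos_of_nonneg_of_pos (abs_nonneg _) hε
    have hA : 0 ≤ ∑ k, a k ^ p :=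
      Finset.sum_nonneg fun k _ => (Real.rpow_pos_of_pos (ha0 k) p).le
    set c : ℝ := (∑ k, a k ^ p) ^ (1 / p - 1) with hc
    have hc0 : 0 ≤ c := Real.rpow_nonneg hA _
    have hle : posHomLp hp n ≤ c • ∑ k, (a k ^ (p - 1)) • |posHomCoord k| := by
      intro b
      have h := rpow_sum_rpow_le_tangent hp hp1 ha0 (fun k => abs_nonneg (b k))
      refine h.trans_eq ?_
      simp only [Submodule.coe_smul, Submodule.coe_sum, Pi.smul_apply, Finset.sum_apply,
        smul_eq_mul]
      rfl
    refine (hφ.monotone hle).trans ?_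
    simp only [map_smul, map_sum, hφ.map_abs, smul_eq_mul]
    calc c * ∑ k, a k ^ (p - 1) * |φ (posHomCoord k)| ≤ c * ∑ k, a k ^ p := by
          refine mul_le_mul_of_nonneg_left (Finset.sum_le_sum fun k _ => ?_) hc0
          calc a k ^ (p - 1) * |φ (posHomCoord k)| ≤ a k ^ (p - 1) * a k :=
                mul_le_mul_of_nonneg_left (le_add_of_nonneg_right hε.le)
                  (Real.rpow_pos_of_pos (ha0 k) _).le
            _ = a k ^ p := by
                rw [← Real.rpow_add_one (ha0 k).ne', sub_add_cancel]
      _ = (∑ k, a k ^ p) ^ (1 / p) := by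
          have hne : (1 / p - 1) + 1 ≠ 0 := by rw [sub_add_cancel]; exact (one_div_pos.2 hp).ne'
          have h := Real.rpow_add' hA hne
          rw [sub_add_cancel, Real.rpow_one] at h
          exact h.symm
  have hcont : Continuous fun ε : ℝ => (∑ k, (|φ (posHomCoord k)| + ε) ^ p) ^ (1 / p) := by
    refine Continuous.rpow_const ?_ (fun _ => Or.inr (one_div_nonneg.2 hp.le))
    exact continuous_finsetSum _ fun k _ =>
      (continuous_const.add continuous_id).rpow_const fun _ => Or.inr hp.le
  have hlim := (hcont.tendsto 0).mono_left (nhdsWithin_le_nhds (s := Set.Ioi 0))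
  simp only [add_zero] at hlim
  exact ge_of_tendsto hlim (eventually_nhdsWithin_of_forall key)

/-- Lattice `p`-convexity with constant `1`. -/
def IsPConvexOne {p : ℝ} (hp : 0 < p) (X : PBanachLattice.{u} p) : Prop :=
  ∀ (n : ℕ) (Φ : posHom n →ₗ[ℝ] X), PreservesLattice Φ →
    ‖Φ (posHomLp hp n)‖ ≤ (∑ k, ‖Φ (posHomCoord k)‖ ^ p) ^ (1 / p)

theorem IsPConvexOne.isPConvex {p : ℝ} {hp : 0 < p} {X : PBanachLattice.{u} p}
    (h : IsPConvexOne hp X) : IsPConvex hp X := by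
  refine ⟨1, one_pos, fun n x Φ hΦ hx => ?_⟩
  rw [one_mul]
  simpa only [hx] using h n Φ hΦ

/-- Each coordinate is a real lattice homomorphism, so the scalar estimate `abs_map_posHomLp_le`
holds coordinatewise; its `p`-th powers are then summed over `Γ`. -/
theorem ellp.isPConvexOne {p : ℝ} {hp : 0 < p} (hp1 : p < 1) {Γ : Type u} :
    IsPConvexOne hp (ellp hp hp1.le Γ) := by
  intro n Φ hΦ
  have h0 : 0 ≤ ∑ k, ‖Φ (posHomCoord k)‖ ^ p :=
    Finset.sum_nonneg fun k _ => Real.rpow_nonneg (PBanachLattice.norm_nonneg _ _) _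
  rw [← Real.rpow_le_rpow_iff (PBanachLattice.norm_nonneg _ _) (Real.rpow_nonneg h0 _) hp,
    ← Real.rpow_mul h0, one_div_mul_cancel hp.ne', Real.rpow_one]
  simp only [ellp.norm_rpow]
  rw [← Summable.tsum_finsetSum fun k _ => ellp.summable_coord_rpow _]
  refine (ellp.summable_coord_rpow _).tsum_le_tsum (fun γ => ?_)
    (summable_sum fun k _ => ellp.summable_coord_rpow _)
  have h := abs_map_posHomLp_le hp hp1 ((ellp.preservesLattice_coord γ).comp hΦ)
  have h1 := Real.rpow_le_rpow (abs_nonneg _) h hp.le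
  rwa [← Real.rpow_mul (Finset.sum_nonneg fun k _ => Real.rpow_nonneg (abs_nonneg _) _),
    one_div_mul_cancel hp.ne', Real.rpow_one] at h1

/-! ### Continuous functions on a compact space -/

theorem isPBanach_of_normedSpace {p : ℝ} (hp : 0 < p) (hp1 : p ≤ 1) (E : Type u)
    [NormedAddCommGroup E] [NormedSpace ℝ E] [CompleteSpace E] : IsPBanach p E where
  norm_nonneg := norm_nonneg
  eq_zero_of_norm_eq_zero _ := norm_eq_zero.1
  norm_smul c x := by rw [norm_smul, Real.norm_eq_abs]
  norm_add_rpow_le x y :=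
    (Real.rpow_le_rpow (norm_nonneg _) (norm_add_le x y) hp.le).trans
      (Real.rpow_add_le_add_rpow (norm_nonneg _) (norm_nonneg _) hp.le hp1)
  complete v hv := by
    have hc : CauchySeq v := Metric.cauchySeq_iff.2 fun ε hε => by
      simpa only [dist_eq_norm] using hv ε hε
    obtain ⟨x, hx⟩ := cauchySeq_tendsto_of_complete hc
    exact ⟨x, tendsto_iff_norm_sub_tendsto_zero.1 hx⟩

/-- The space `C(K)` as a `p`-Banach lattice. -/
noncomputable def continuousMapLattice {p : ℝ} (hp : 0 < p) (hp1 : p ≤ 1) (K : Type u)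
    [TopologicalSpace K] [CompactSpace K] : PBanachLattice.{u} p :=
  letI := isPBanach_of_normedSpace hp hp1 C(K, ℝ)
  { carrier := C(K, ℝ)
    add_le_add := fun _ _ _ h t => by simpa using h t
    smul_le_smul := fun _ _ _ hc h t => mul_le_mul_of_nonneg_left (h t) hc
    solid := fun f g h => by
      refine (ContinuousMap.norm_le _ (norm_nonneg g)).2 fun t => ?_
      have ht : |f t| ≤ |g t| := by simpa using h t
      exact ht.trans (g.norm_coe_le_norm t) }

namespace continuousMapLattice

variable {p : ℝ} {hp : 0 < p} {hp1 : p ≤ 1} {K : Type u} [TopologicalSpace K] [CompactSpace K]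

/-- The evaluation functionals on `C(K)`. -/
noncomputable def eval (t : K) : continuousMapLattice hp hp1 K →ₗ[ℝ] ℝ where
  toFun f := (show C(K, ℝ) from f) t
  map_add' _ _ := rfl
  map_smul' _ _ := rfl

theorem preservesLattice_eval (t : K) :
    PreservesLattice (eval t : continuousMapLattice hp hp1 K →ₗ[ℝ] ℝ) :=
  ⟨fun _ _ => rfl, fun _ _ => rfl⟩

theorem continuous_eval_apply (f : continuousMapLattice hp hp1 K) :
    Continuous fun t => eval t f :=
  (show C(K, ℝ) from f).continuous

theorem exists_eval_eq {f : K → ℝ} (hf : Continuous f) :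
    ∃ g : continuousMapLattice hp hp1 K, ∀ t, eval t g = f t :=
  ⟨(⟨f, hf⟩ : C(K, ℝ)), fun _ => rfl⟩

theorem abs_eval_le_norm (t : K) (f : continuousMapLattice hp hp1 K) : |eval t f| ≤ ‖f‖ :=
  (show C(K, ℝ) from f).norm_coe_le_norm t

theorem norm_le {f : continuousMapLattice hp hp1 K} {C : ℝ} (hC : 0 ≤ C)
    (h : ∀ t, |eval t f| ≤ C) : ‖f‖ ≤ C :=
  (ContinuousMap.norm_le (show C(K, ℝ) from f) hC).2 h

theorem isPConvexOne {hp1 : p < 1} : IsPConvexOne hp (continuousMapLattice hp hp1.le K) := by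
  intro n Φ hΦ
  refine norm_le (Real.rpow_nonneg (Finset.sum_nonneg fun k _ =>
    Real.rpow_nonneg (PBanachLattice.norm_nonneg _ _) _) _) fun t => ?_
  refine (abs_map_posHomLp_le hp hp1 ((preservesLattice_eval t).comp hΦ)).trans ?_
  refine Real.rpow_le_rpow (Finset.sum_nonneg fun k _ => Real.rpow_nonneg (abs_nonneg _) _)
    (Finset.sum_le_sum fun k _ => ?_) (one_div_nonneg.2 hp.le)
  exact Real.rpow_le_rpow (abs_nonneg _) (abs_eval_le_norm t _) hp.le

end continuousMapLattice

/-! ### Products and closed sublattices -/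

section AbsClosed

variable {E : Type*} [AddCommGroup E] [Module ℝ E] [Lattice E] [IsOrderedAddMonoid E]

theorem Submodule.sup_mem_of_abs_mem {S : Submodule ℝ E} (h : ∀ x ∈ S, |x| ∈ S) {x y : E}
    (hx : x ∈ S) (hy : y ∈ S) : x ⊔ y ∈ S := by
  rw [sup_eq_half_smul_add_add_abs_sub' ℝ]
  exact S.smul_mem _ (S.add_mem (S.add_mem hx hy) (h _ (S.sub_mem hy hx)))

theorem Submodule.inf_mem_of_abs_mem {S : Submodule ℝ E} (h : ∀ x ∈ S, |x| ∈ S) {x y : E}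
    (hx : x ∈ S) (hy : y ∈ S) : x ⊓ y ∈ S := by
  rw [inf_eq_half_smul_add_sub_abs_sub' ℝ]
  exact S.smul_mem _ (S.sub_mem (S.add_mem hx hy) (h _ (S.sub_mem hy hx)))

end AbsClosed

namespace PBanachLattice

variable {p : ℝ}

protected theorem norm_add_le (X : PBanachLattice.{u} p) (hp : 0 < p) (x y : X) :
    ‖x + y‖ ≤ (‖x‖ ^ p + ‖y‖ ^ p) ^ p⁻¹ := by
  have h := Real.rpow_le_rpow (Real.rpow_nonneg (X.norm_nonneg _) _)
    (IsPBanach.norm_add_rpow_le (p := p) x y) (inv_nonneg.2 hp.le)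
  rwa [← Real.rpow_mul (X.norm_nonneg _), mul_inv_cancel₀ hp.ne', Real.rpow_one] at h

theorem injective_of_isometry {F : PBanachLattice.{u} p} {Y : PBanachLattice.{v} p}
    {e : F →ₗ[ℝ] Y} (hn : ∀ x, ‖e x‖ = ‖x‖) : Function.Injective e := by
  refine (injective_iff_map_eq_zero e).2 fun x hx => ?_
  refine IsPBanach.eq_zero_of_norm_eq_zero p x ?_
  rw [← hn, hx, Y.norm_zero]

section Pi

variable {I : Type w}

/-- The bounded families in a product of `p`-Banach lattices. -/
def boundedFamilies (hp : 0 < p) (X : I → PBanachLattice.{v} p) :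
    Submodule ℝ (∀ i, X i) where
  carrier := {f | ∃ C : ℝ, ∀ i, ‖f i‖ ≤ C}
  add_mem' := by
    rintro f g ⟨C, hC⟩ ⟨D, hD⟩
    refine ⟨(C ^ p + D ^ p) ^ p⁻¹, fun i => ((X i).norm_add_le hp _ _).trans ?_⟩
    have h1 := Real.rpow_nonneg ((X i).norm_nonneg (f i)) p
    have h2 := Real.rpow_nonneg ((X i).norm_nonneg (g i)) p
    exact Real.rpow_le_rpow (add_nonneg h1 h2)
      (_root_.add_le_add (Real.rpow_le_rpow ((X i).norm_nonneg _) (hC i) hp.le)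
        (Real.rpow_le_rpow ((X i).norm_nonneg _) (hD i) hp.le)) (inv_nonneg.2 hp.le)
  zero_mem' := ⟨0, fun i => (X i).norm_zero.le⟩
  smul_mem' := by
    rintro c f ⟨C, hC⟩
    refine ⟨|c| * C, fun i => ?_⟩
    rw [Pi.smul_apply, (X i).norm_smul]
    exact mul_le_mul_of_nonneg_left (hC i) (abs_nonneg c)

variable {hp : 0 < p} {X : I → PBanachLattice.{v} p}

theorem abs_mem_boundedFamilies (f : ∀ i, X i) (hf : f ∈ boundedFamilies hp X) :
    |f| ∈ boundedFamilies hp X := by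
  obtain ⟨C, hC⟩ := hf
  exact ⟨C, fun i => by rw [Pi.abs_apply, (X i).norm_abs]; exact hC i⟩

noncomputable instance : Lattice (boundedFamilies hp X) :=
  Subtype.lattice (P := fun f => f ∈ boundedFamilies hp X)
    (fun _ _ => Submodule.sup_mem_of_abs_mem abs_mem_boundedFamilies)
    (fun _ _ => Submodule.inf_mem_of_abs_mem abs_mem_boundedFamilies)

noncomputable instance : Norm (boundedFamilies hp X) := ⟨fun f => ⨆ i, ‖f.1 i‖⟩

theorem boundedFamilies_norm_apply_le (f : boundedFamilies hp X) (i : I) : ‖f.1 i‖ ≤ ‖f‖ := by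
  obtain ⟨C, hC⟩ := f.2
  exact le_ciSup (f := fun i => ‖f.1 i‖) ⟨C, by rintro _ ⟨i, rfl⟩; exact hC i⟩ i

/-- The condition `0 ≤ C` matters only for empty `I`, where the supremum is `0` by convention. -/
theorem boundedFamilies_norm_le {f : boundedFamilies hp X} {C : ℝ} (hC : 0 ≤ C)
    (h : ∀ i, ‖f.1 i‖ ≤ C) : ‖f‖ ≤ C :=
  Real.iSup_le h hC

theorem boundedFamilies_norm_nonneg (f : boundedFamilies hp X) : 0 ≤ ‖f‖ :=
  Real.iSup_nonneg fun i => (X i).norm_nonneg _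

theorem isPBanach_boundedFamilies : IsPBanach p (boundedFamilies hp X) where
  norm_nonneg := boundedFamilies_norm_nonneg
  eq_zero_of_norm_eq_zero f h := by
    refine Subtype.ext (funext fun i => IsPBanach.eq_zero_of_norm_eq_zero p _ ?_)
    exact le_antisymm ((boundedFamilies_norm_apply_le f i).trans h.le) ((X i).norm_nonneg _)
  norm_smul c f := by
    have h : ∀ i, ‖(c • f).1 i‖ = |c| * ‖f.1 i‖ := fun i => (X i).norm_smul c _
    change ⨆ i, ‖(c • f).1 i‖ = |c| * ⨆ i, ‖f.1 i‖
    simp only [h]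
    exact (Real.mul_iSup_of_nonneg (abs_nonneg c) _).symm
  norm_add_rpow_le f g := by
    have hf := boundedFamilies_norm_nonneg f
    have hg := boundedFamilies_norm_nonneg g
    have h0 : 0 ≤ ‖f‖ ^ p + ‖g‖ ^ p := add_nonneg (Real.rpow_nonneg hf p) (Real.rpow_nonneg hg p)
    have h : ‖f + g‖ ≤ (‖f‖ ^ p + ‖g‖ ^ p) ^ p⁻¹ := by
      refine boundedFamilies_norm_le (Real.rpow_nonneg h0 _) fun i => ?_
      refine ((X i).norm_add_le hp (f.1 i) (g.1 i)).trans ?_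
      refine Real.rpow_le_rpow (add_nonneg (Real.rpow_nonneg ((X i).norm_nonneg _) p)
        (Real.rpow_nonneg ((X i).norm_nonneg _) p)) (_root_.add_le_add ?_ ?_) (inv_nonneg.2 hp.le)
      · exact Real.rpow_le_rpow ((X i).norm_nonneg _) (boundedFamilies_norm_apply_le f i) hp.le
      · exact Real.rpow_le_rpow ((X i).norm_nonneg _) (boundedFamilies_norm_apply_le g i) hp.le
    have h1 := Real.rpow_le_rpow (boundedFamilies_norm_nonneg _) h hp.le
    rwa [← Real.rpow_mul h0, inv_mul_cancel₀ hp.ne', Real.rpow_one] at h1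
  complete v hv := by
    have : Fact (0 < p) := ⟨hp⟩
    have hx : ∀ i, ∃ x : X i, Tendsto (fun n => ‖(v n).1 i - x‖) atTop (𝓝 0) := fun i =>
      IsPBanach.complete p _ fun ε hε => by
        obtain ⟨N, hN⟩ := hv ε hε
        exact ⟨N, fun m hm n hn =>
          (boundedFamilies_norm_apply_le (v m - v n) i).trans_lt (hN m hm n hn)⟩
    choose x hx using hx
    have key : ∀ ε > 0, ∃ N, ∀ n ≥ N, ∀ i, ‖(v n).1 i - x i‖ ≤ ε := by
      intro ε hε
      obtain ⟨N, hN⟩ := hv ε hε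
      refine ⟨N, fun n hn i => ?_⟩
      have hlim : Tendsto (fun m => ‖(v n).1 i - (v m).1 i‖) atTop (𝓝 ‖(v n).1 i - x i‖) :=
        ((X i).continuous_norm.tendsto _).comp (tendsto_const_nhds.sub (tendsto_iff.2 (hx i)))
      exact le_of_tendsto hlim (eventually_atTop.2 ⟨N, fun m hm =>
        (boundedFamilies_norm_apply_le (v n - v m) i).trans (hN n hn m hm).le⟩)
    obtain ⟨N, hN⟩ := key 1 one_pos
    have hmem : x ∈ boundedFamilies hp X := by
      have h := (boundedFamilies hp X).sub_mem (v N).2 (y := (v N).1 - x) ⟨1, hN N le_rfl⟩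
      rwa [sub_sub_cancel] at h
    refine ⟨⟨x, hmem⟩, Metric.tendsto_atTop.2 fun ε hε => ?_⟩
    obtain ⟨M, hM⟩ := key (ε / 2) (half_pos hε)
    refine ⟨M, fun n hn => ?_⟩
    rw [Real.dist_eq, sub_zero, abs_of_nonneg (boundedFamilies_norm_nonneg _)]
    exact (boundedFamilies_norm_le (half_pos hε).le (hM n hn)).trans_lt (half_lt_self hε)

variable (hp X) in
/-- The `ℓ_∞`-product of a family of `p`-Banach lattices. -/
noncomputable def pi : PBanachLattice.{max w v} p :=
  letI := isPBanach_boundedFamilies (hp := hp) (X := X)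
  { carrier := boundedFamilies hp X
    add_le_add := fun f g h hfg i => (X i).add_le_add _ _ _ ((show f.1 ≤ g.1 from hfg) i)
    smul_le_smul := fun c f g hc hfg i => (X i).smul_le_smul _ _ _ hc ((show f.1 ≤ g.1 from hfg) i)
    solid := fun f g h => by
      refine boundedFamilies_norm_le (boundedFamilies_norm_nonneg g) fun i => ?_
      exact ((X i).solid _ _ (h i)).trans (boundedFamilies_norm_apply_le g i) }

/-- The coordinate maps of a product. -/
noncomputable def pi.proj (i : I) : pi hp X →ₗ[ℝ] X i where
  toFun f := (show boundedFamilies hp X from f).1 i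
  map_add' _ _ := rfl
  map_smul' _ _ := rfl

theorem pi.preservesLattice_proj (i : I) :
    PreservesLattice (pi.proj i : pi hp X →ₗ[ℝ] X i) :=
  ⟨fun _ _ => rfl, fun _ _ => rfl⟩

theorem pi.ext {f g : pi hp X} (h : ∀ i, pi.proj i f = pi.proj i g) : f = g :=
  Subtype.ext (funext h)

theorem pi.norm_proj_le (f : pi hp X) (i : I) : ‖pi.proj i f‖ ≤ ‖f‖ :=
  boundedFamilies_norm_apply_le (show boundedFamilies hp X from f) i

theorem pi.norm_le {f : pi hp X} {C : ℝ} (hC : 0 ≤ C) (h : ∀ i, ‖pi.proj i f‖ ≤ C) : ‖f‖ ≤ C :=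
  boundedFamilies_norm_le (f := (show boundedFamilies hp X from f)) hC h

theorem pi.exists_lift {E : Type*} [AddCommGroup E] [Module ℝ E] [Norm E] (T : ∀ i, E →ₗ[ℝ] X i)
    (hT : ∀ i e, ‖T i e‖ ≤ ‖e‖) : ∃ S : E →ₗ[ℝ] pi hp X, ∀ i e, pi.proj i (S e) = T i e :=
  ⟨(LinearMap.pi T).codRestrict (boundedFamilies hp X) fun e => ⟨‖e‖, fun i => hT i e⟩,
    fun _ _ => rfl⟩

theorem pi.isPConvexOne (hX : ∀ i, IsPConvexOne hp (X i)) : IsPConvexOne hp (pi hp X) := by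
  intro n Φ hΦ
  refine pi.norm_le (Real.rpow_nonneg (Finset.sum_nonneg fun k _ =>
    Real.rpow_nonneg (PBanachLattice.norm_nonneg _ _) _) _) fun i => ?_
  refine (hX i n (pi.proj i ∘ₗ Φ) ((pi.preservesLattice_proj i).comp hΦ)).trans ?_
  refine Real.rpow_le_rpow (Finset.sum_nonneg fun k _ =>
    Real.rpow_nonneg ((X i).norm_nonneg _) _) (Finset.sum_le_sum fun k _ => ?_)
    (one_div_nonneg.2 hp.le)
  exact Real.rpow_le_rpow ((X i).norm_nonneg _) (pi.norm_proj_le _ i) hp.le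

end Pi

/-- A vector space that is embedded in a `p`-Banach lattice as a closed sublattice is a
`p`-Banach lattice. -/
theorem exists_of_injective [hp : Fact (0 < p)] {Y : PBanachLattice.{v} p} {A : Type u}
    [AddCommGroup A] [Module ℝ A] (j : A →ₗ[ℝ] Y) (hj : Function.Injective j)
    (habs : ∀ a, ∃ b, j b = |j a|) (hcl : IsClosed (Set.range j)) :
    ∃ (F : PBanachLattice.{u} p) (e : F →ₗ[ℝ] Y), PreservesLattice e ∧ (∀ x, ‖e x‖ = ‖x‖) ∧
      Set.range e = Set.range j := by
  have hr : ∀ y ∈ LinearMap.range j, |y| ∈ LinearMap.range j := by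
    rintro _ ⟨a, rfl⟩
    exact habs a
  choose sup hsup using fun a b : A =>
    Submodule.sup_mem_of_abs_mem hr (LinearMap.mem_range_self j a) (LinearMap.mem_range_self j b)
  choose inf hinf using fun a b : A =>
    Submodule.inf_mem_of_abs_mem hr (LinearMap.mem_range_self j a) (LinearMap.mem_range_self j b)
  let _ : Max A := ⟨sup⟩
  let _ : Min A := ⟨inf⟩
  let _ : LE A := ⟨fun a b => j a ≤ j b⟩
  let _ : LT A := ⟨fun a b => j a < j b⟩
  let _ : Lattice A := hj.lattice j Iff.rfl Iff.rfl hsup hinf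
  let _ : Norm A := ⟨fun a => ‖j a‖⟩
  have hjabs : ∀ a : A, j |a| = |j a| := fun a => by
    rw [abs, abs, ← map_neg]; exact hsup a (-a)
  have hB : IsPBanach p A :=
    { norm_nonneg := fun a => Y.norm_nonneg _
      eq_zero_of_norm_eq_zero := fun a h =>
        hj ((IsPBanach.eq_zero_of_norm_eq_zero p (j a) h).trans (map_zero j).symm)
      norm_smul := fun c a => by
        change ‖j (c • a)‖ = |c| * ‖j a‖
        rw [map_smul, Y.norm_smul]
      norm_add_rpow_le := fun a b => by
        change ‖j (a + b)‖ ^ p ≤ ‖j a‖ ^ p + ‖j b‖ ^ p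
        rw [map_add]
        exact IsPBanach.norm_add_rpow_le _ _
      complete := fun v hv => by
        obtain ⟨y, hy⟩ := IsPBanach.complete p (fun n => j (v n)) fun ε hε => by
          obtain ⟨N, hN⟩ := hv ε hε
          refine ⟨N, fun m hm n hn => ?_⟩
          rw [← map_sub]
          exact hN m hm n hn
        obtain ⟨a, rfl⟩ := hcl.mem_of_tendsto (tendsto_iff.2 hy)
          (Eventually.of_forall fun n => Set.mem_range_self (v n))
        refine ⟨a, hy.congr fun n => ?_⟩
        rw [← map_sub]
        rfl }
  refine ⟨{ carrier := A
            add_le_add := fun a b c h => ?_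
            smul_le_smul := fun c a b hc h => ?_
            solid := fun a b h => ?_ }, j, ⟨hsup, hinf⟩, fun _ => rfl, rfl⟩
  · change j (a + c) ≤ j (b + c)
    rw [map_add, map_add]
    exact Y.add_le_add _ _ _ h
  · change j (c • a) ≤ j (c • b)
    rw [map_smul, map_smul]
    exact Y.smul_le_smul _ _ _ hc h
  · refine Y.solid _ _ ?_
    rw [← hjabs, ← hjabs]
    exact h

theorem _root_.IsPConvexOne.of_isometry {hp : 0 < p} {F : PBanachLattice.{u} p}
    {Y : PBanachLattice.{v} p} (hY : IsPConvexOne hp Y) {e : F →ₗ[ℝ] Y} (he : PreservesLattice e)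
    (hn : ∀ x, ‖e x‖ = ‖x‖) : IsPConvexOne hp F := by
  intro n Φ hΦ
  simpa [hn] using hY n (e ∘ₗ Φ) (he.comp hΦ)

end PBanachLattice

/-! ### Uncountable index sets -/

/-- If `Γ` were uncountable, some `γ` would lie outside a sequence of distinct points `f n` and
outside all the sets `s (f n)`. Then every `f n` would belong to the finite set `s γ`. -/
theorem countable_of_forall_mem_or_mem {Γ : Type*} (s : Γ → Finset Γ)
    (h : ∀ γ γ', γ ≠ γ' → γ ∈ s γ' ∨ γ' ∈ s γ) : Countable Γ := by
  by_contra hΓ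
  rw [not_countable_iff] at hΓ
  obtain ⟨f⟩ : Nonempty (ℕ ↪ Γ) := ⟨Infinite.natEmbedding Γ⟩
  have hC : (⋃ n, (insert (f n) (s (f n) : Set Γ))).Countable :=
    Set.countable_iUnion fun n => ((s (f n)).finite_toSet.insert _).countable
  obtain ⟨γ, hγ⟩ := (Set.ne_univ_iff_exists_notMem
      (⋃ n, (insert (f n) (s (f n) : Set Γ)))).1 fun h => Set.not_countable_univ (h ▸ hC)
  simp only [Set.mem_iUnion, Set.mem_insert_iff, not_exists, not_or, Finset.mem_coe] at hγ
  obtain ⟨_, ⟨n, rfl⟩, hn⟩ :=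
    (Set.infinite_range_of_injective f.injective).exists_notMem_finset (s γ)
  rcases h γ (f n) (hγ n).1 with h1 | h1
  · exact (hγ n).2 h1
  · exact hn h1

namespace PBanachLattice

theorem pi.exists_proj_bool_eq {p : ℝ} {hp : 0 < p} {X : Bool → PBanachLattice.{u} p}
    (x₁ : X true) (x₂ : X false) {C : ℝ} (hC : 0 ≤ C) (h₁ : ‖x₁‖ ≤ C) (h₂ : ‖x₂‖ ≤ C) :
    ∃ y : pi hp X, pi.proj true y = x₁ ∧ pi.proj false y = x₂ ∧ ‖y‖ ≤ C := by
  let y : ∀ b, X b := fun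
    | true => x₁
    | false => x₂
  have hb : ∀ b, ‖y b‖ ≤ C := by
    rintro (_ | _)
    exacts [h₂, h₁]
  exact ⟨(⟨y, C, hb⟩ : boundedFamilies hp X), rfl, rfl, pi.norm_le hC hb⟩

/-- The product of two `p`-Banach lattices with the maximum norm. -/
theorem exists_prod {p : ℝ} (hp : 0 < p) (X₁ X₂ : PBanachLattice.{u} p) :
    ∃ (Y : PBanachLattice.{u} p) (P₁ : Y →ₗ[ℝ] X₁) (P₂ : Y →ₗ[ℝ] X₂),
      PreservesLattice P₁ ∧ PreservesLattice P₂ ∧ (∀ y, ‖P₁ y‖ ≤ ‖y‖) ∧ (∀ y, ‖P₂ y‖ ≤ ‖y‖) ∧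
      (∀ x₁ x₂ C, 0 ≤ C → ‖x₁‖ ≤ C → ‖x₂‖ ≤ C → ∃ y, P₁ y = x₁ ∧ P₂ y = x₂ ∧ ‖y‖ ≤ C) ∧
      (IsPConvexOne hp X₁ → IsPConvexOne hp X₂ → IsPConvexOne hp Y) := by
  let X : Bool → PBanachLattice.{u} p := fun b => Bool.rec X₂ X₁ b
  exact ⟨pi hp X, pi.proj (X := X) true, pi.proj (X := X) false,
    pi.preservesLattice_proj (X := X) true, pi.preservesLattice_proj (X := X) false,
    fun y => pi.norm_proj_le (X := X) y true, fun y => pi.norm_proj_le (X := X) y false,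
    fun x₁ x₂ C hC h₁ h₂ => pi.exists_proj_bool_eq (X := X) x₁ x₂ hC h₁ h₂,
    fun h₁ h₂ => pi.isPConvexOne (X := X) (Bool.rec h₂ h₁)⟩

end PBanachLattice

namespace ellp

variable {p : ℝ} {hp : 0 < p} {Γ : Type u}

open Classical in
/-- The indicator function of `{γ}`. -/
noncomputable def singletonIndicator (γ : Γ) : Γ → Bool := fun i => decide (i = γ)

/-- `R` sends `unit γ` to the indicator of `t γ = true`, a continuous function of norm at most `1`
whose value at the indicator of `{γ'}` is `1` or `0` according to whether `γ' = γ`. -/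
theorem exists_map_eval_singletonIndicator [Fact (0 < p)] (hp1 : p ≤ 1) :
    ∃ R : ellp hp hp1 Γ →ₗ[ℝ] continuousMapLattice hp hp1 (Γ → Bool),
      (∀ a, ‖R a‖ ≤ ‖a‖) ∧
      ∀ a γ, continuousMapLattice.eval (singletonIndicator γ) (R a) = coord γ a := by
  choose y hy using fun γ : Γ =>
    continuousMapLattice.exists_eval_eq (hp := hp) (hp1 := hp1) (K := Γ → Bool)
      (f := fun t => if t γ = true then 1 else 0)
      ((continuous_of_discreteTopology (f := fun b : Bool => if b = true then (1 : ℝ) else 0)).comp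
        (continuous_apply γ))
  obtain ⟨R, hRu, hRb⟩ := exists_map_unit_eq (hp := hp) (hp1 := hp1) y zero_le_one fun γ => by
    refine continuousMapLattice.norm_le zero_le_one fun t => ?_
    rw [hy]
    split_ifs <;> simp
  refine ⟨R, fun a => by simpa using hRb a, fun a γ => ?_⟩
  have hev : Continuous (continuousMapLattice.eval (hp := hp) (hp1 := hp1)
      (singletonIndicator γ)) :=
    PBanachLattice.continuous_real_of_bound (C := 1) fun f => by
      rw [one_mul]; exact continuousMapLattice.abs_eval_le_norm _ f
  have h : continuousMapLattice.eval (singletonIndicator γ) ∘ₗ R = coord γ := by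
    refine linearMap_ext (hev.comp (PBanachLattice.continuous_of_bound hRb))
      (continuous_coord γ) fun γ' => ?_
    rw [LinearMap.comp_apply, hRu, hy, coord_unit]
    by_cases hγ : γ = γ' <;> simp [singletonIndicator, hγ, eq_comm]
  exact LinearMap.congr_fun h a

/-- `ℓ_p(Γ)` is a lattice quotient of a lattice of continuous functions on the Cantor cube of
weight `Γ`, by the evaluations at singletons. -/
theorem exists_latticeQuotient (hp1 : p < 1) :
    ∃ (X : PBanachLattice.{u} p) (π : X →ₗ[ℝ] ellp hp hp1.le Γ)
      (e : X →ₗ[ℝ] continuousMapLattice hp hp1.le (Γ → Bool)),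
      IsPConvexOne hp X ∧ IsLatticeQuotient π ∧ PreservesLattice e ∧
      ∀ x γ, continuousMapLattice.eval (singletonIndicator γ) (e x) = coord γ (π x) := by
  have : Fact (0 < p) := ⟨hp⟩
  obtain ⟨Y, P₁, P₂, hP₁, hP₂, hn₁, hn₂, hY, hYc⟩ := PBanachLattice.exists_prod hp
    (continuousMapLattice hp hp1.le (Γ → Bool)) (ellp hp hp1.le Γ)
  have hc₁ : Continuous P₁ := PBanachLattice.continuous_of_bound (C := 1) (by simpa using hn₁)
  have hc₂ : Continuous P₂ := PBanachLattice.continuous_of_bound (C := 1) (by simpa using hn₂)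
  let ev : Γ → Y →ₗ[ℝ] ℝ := fun γ => continuousMapLattice.eval (singletonIndicator γ) ∘ₗ P₁
  let co : Γ → Y →ₗ[ℝ] ℝ := fun γ => coord γ ∘ₗ P₂
  have hev : ∀ γ, Continuous (ev γ) := fun γ =>
    PBanachLattice.continuous_real_of_bound (C := 1) fun y => by
      rw [one_mul]
      exact (continuousMapLattice.abs_eval_le_norm _ (P₁ y)).trans (hn₁ y)
  have hco : ∀ γ, Continuous (co γ) := fun γ => (continuous_coord γ).comp hc₂
  have hevl : ∀ γ, PreservesLattice (ev γ) := fun γ =>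
    (continuousMapLattice.preservesLattice_eval _).comp hP₁
  have hcol : ∀ γ, PreservesLattice (co γ) := fun γ => (preservesLattice_coord γ).comp hP₂
  -- The pairs `(f, a)` with `f(1_{γ}) = a_γ` for every `γ`: an intersection of equalizers of
  -- continuous lattice homomorphisms, hence a closed sublattice.
  let A : Submodule ℝ Y := ⨅ γ, LinearMap.eqLocus (ev γ) (co γ)
  have hA : ∀ {y}, y ∈ A ↔ ∀ γ, ev γ y = co γ y := by
    intro y
    simp only [A, Submodule.mem_iInf, LinearMap.mem_eqLocus]
  have hcl : IsClosed (Set.range A.subtype) := by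
    have : Set.range A.subtype = ⋂ γ, {y | ev γ y = co γ y} := by
      ext y
      simp only [Submodule.coe_subtype, Subtype.range_coe_subtype, Set.mem_ofPred_eq, hA,
        Set.mem_iInter]
    rw [this]
    exact isClosed_iInter fun γ => isClosed_eq (hev γ) (hco γ)
  obtain ⟨X, e, hel, hen, her⟩ := PBanachLattice.exists_of_injective A.subtype
    A.injective_subtype
    (fun a => ⟨⟨|(a : Y)|, hA.2 fun γ => by
      rw [(hevl γ).map_abs, (hcol γ).map_abs, hA.1 a.2 γ]⟩, rfl⟩) hcl
  have hmem : ∀ x, e x ∈ A := fun x => by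
    have : e x ∈ Set.range A.subtype := her ▸ Set.mem_range_self x
    obtain ⟨a, ha⟩ := this
    exact ha ▸ a.2
  obtain ⟨R, hRn, hRe⟩ := exists_map_eval_singletonIndicator (hp := hp) (Γ := Γ) hp1.le
  -- The pair `(R z, z)` lies over `z` and has norm at most `‖z‖`, so the infimum in the quotient
  -- norm is attained.
  have hsec : ∀ z : ellp hp hp1.le Γ, ∃ x : X, P₂ (e x) = z ∧ ‖x‖ ≤ ‖z‖ := by
    intro z
    obtain ⟨y, hy₁, hy₂, hyn⟩ := hY (R z) z ‖z‖ (PBanachLattice.norm_nonneg _ z) (hRn z) le_rfl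
    have hyA : y ∈ A := hA.2 fun γ => by
      simp only [ev, co, LinearMap.comp_apply, hy₁, hy₂, hRe]
    have : y ∈ Set.range e := her ▸ ⟨⟨y, hyA⟩, rfl⟩
    obtain ⟨x, rfl⟩ := this
    exact ⟨x, hy₂, (hen x).symm.le.trans hyn⟩
  have hle : ∀ x, ‖P₂ (e x)‖ ≤ ‖x‖ := fun x => (hn₂ _).trans (hen x).le
  refine ⟨X, P₂ ∘ₗ e, P₁ ∘ₗ e, ?_, ⟨⟨hP₂.comp hel, 1, fun x => by simpa using hle x⟩, fun z => ?_,
    fun z => ?_⟩, hP₁.comp hel, fun x γ => hA.1 (hmem x) γ⟩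
  · exact (hYc (continuousMapLattice.isPConvexOne (hp1 := hp1)) (ellp.isPConvexOne hp1)).of_isometry hel hen
  · obtain ⟨x, hx, -⟩ := hsec z
    exact ⟨x, hx⟩
  · refine ⟨?_, fun r hr => ?_⟩
    · rintro _ ⟨x, rfl, rfl⟩
      exact hle x
    · obtain ⟨x, hx, hxn⟩ := hsec z
      exact (hr ⟨x, hx, rfl⟩).trans hxn

theorem countable_of_isProjectiveConst {hp1 : p < 1} {𝒞 : PBanachLattice.{u} p → Prop}
    (h𝒞 : ∀ X, IsPConvexOne hp X → 𝒞 X) {l : ℝ}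
    (h : IsProjectiveConst 𝒞 l (ellp hp hp1.le Γ)) : Countable Γ := by
  classical
  obtain ⟨X, π, e, hXc, hπ, he, hev⟩ := exists_latticeQuotient (hp := hp) (Γ := Γ) hp1
  obtain ⟨S, hS, hπS, -⟩ := h X _ (h𝒞 X hXc) (h𝒞 _ (ellp.isPConvexOne hp1)) π hπ LinearMap.id
    ⟨⟨fun _ _ => rfl, fun _ _ => rfl⟩, 1, fun x => by simp⟩
  let f : Γ → (Γ → Bool) → ℝ := fun γ t => continuousMapLattice.eval t (e (S (unit γ)))
  have hf1 : ∀ γ, f γ (singletonIndicator γ) = 1 := fun γ => by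
    have h1 : π (S (unit γ)) = unit γ := LinearMap.congr_fun hπS _
    simp only [f, hev, h1, coord_unit_self]
  have hfc : ∀ γ, Continuous (f γ) := fun γ => continuousMapLattice.continuous_eval_apply _
  have hfd : ∀ γ γ' t, γ ≠ γ' → f γ t ⊓ f γ' t = 0 := by
    intro γ γ' t hne
    have hu : (unit γ : ellp hp hp1.le Γ) ⊓ unit γ' = 0 := by
      refine ext fun i => ?_
      rw [(preservesLattice_coord i).2, coord_unit, coord_unit, map_zero]
      split_ifs with h1 h2 h2
      · exact absurd (h1.symm.trans h2) hne
      all_goals norm_num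
    simp only [f]
    rw [← (continuousMapLattice.preservesLattice_eval t).2, ← he.2, ← hS.1.2, hu, map_zero,
      map_zero, map_zero]
  -- Positivity of `f γ` near the indicator of `{γ}` is ensured by finitely many coordinates, by the
  -- definition of the product topology.
  have hs : ∀ γ, ∃ s : Finset Γ, ∀ t : Γ → Bool,
      (∀ i ∈ s, t i = singletonIndicator γ i) → 0 < f γ t := by
    intro γ
    have hopen : IsOpen {t | 0 < f γ t} := isOpen_lt continuous_const (hfc γ)
    obtain ⟨s, U, hU, hsub⟩ := isOpen_pi_iff.1 hopen (singletonIndicator γ)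
      (by rw [Set.mem_ofPred_eq, hf1]; exact one_pos)
    refine ⟨s, fun t ht => hsub fun i hi => ?_⟩
    rw [ht i hi]
    exact (hU i hi).2
  choose s hs using hs
  refine countable_of_forall_mem_or_mem s fun γ γ' hne => ?_
  by_contra hcon
  rw [not_or] at hcon
  -- The indicator of `{γ, γ'}` agrees with that of `{γ}` on `s γ` and with that of `{γ'}` on `s
  -- γ'`, so both functions are positive there.
  let t : Γ → Bool := fun i => decide (i = γ ∨ i = γ')
  have h1 : 0 < f γ t := hs γ t fun i hi => by
    have : i ≠ γ' := fun h => hcon.2 (h ▸ hi)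
    simp [t, singletonIndicator, this]
  have h2 : 0 < f γ' t := hs γ' t fun i hi => by
    have : i ≠ γ := fun h => hcon.1 (h ▸ hi)
    simp [t, singletonIndicator, this]
  exact (lt_inf_iff.2 ⟨h1, h2⟩).ne' (hfd γ γ' t hne)

end ellp

/-! ### Free `p`-Banach lattices -/

/-- Terms for the elements of a closed sublattice generated by `E`. -/
inductive LatticeTerm (E : Type u) : Type u
  | of (e : E)
  | add (s t : LatticeTerm E)
  | smul (c : ℝ) (t : LatticeTerm E)
  | abs (t : LatticeTerm E)
  | lim (s : ℕ → LatticeTerm E)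

namespace LatticeTerm

variable {p : ℝ} [hp : Fact (0 < p)] {E : Type u} {Y : PBanachLattice.{v} p}

open Classical in
/-- The value of a term under an assignment of its generators; a divergent limit has value `0`. -/
noncomputable def eval (D : E → Y) : LatticeTerm E → Y
  | of e => D e
  | add s t => eval D s + eval D t
  | smul c t => c • eval D t
  | abs t => |eval D t|
  | lim s => if h : ∃ y, Tendsto (fun n => eval D (s n)) atTop (𝓝 y) then h.choose else 0

theorem eval_lim {D : E → Y} {s : ℕ → LatticeTerm E} {y : Y}
    (h : Tendsto (fun n => eval D (s n)) atTop (𝓝 y)) : eval D (lim s) = y := by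
  have h' : ∃ y, Tendsto (fun n => eval D (s n)) atTop (𝓝 y) := ⟨y, h⟩
  rw [eval, dif_pos h']
  exact tendsto_nhds_unique h'.choose_spec h

theorem eval_lim_of_not_exists {D : E → Y} {s : ℕ → LatticeTerm E}
    (h : ¬∃ y, Tendsto (fun n => eval D (s n)) atTop (𝓝 y)) : eval D (lim s) = 0 := by
  rw [eval, dif_neg h]

theorem isClosed_range_eval (D : E → Y) : IsClosed (Set.range (eval D)) := by
  refine isClosed_of_closure_subset fun y hy => ?_
  obtain ⟨x, hx, hxy⟩ := mem_closure_iff_seq_limit.1 hy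
  choose s hs using hx
  refine ⟨lim s, eval_lim ?_⟩
  simpa only [hs] using hxy

/-- The closed sublattice generated by the range of `D`. -/
noncomputable def rangeEval [AddCommGroup E] [Module ℝ E] (D : E →ₗ[ℝ] Y) : Submodule ℝ Y where
  carrier := Set.range (eval D)
  add_mem' := by
    rintro _ _ ⟨s, rfl⟩ ⟨t, rfl⟩
    exact ⟨add s t, rfl⟩
  zero_mem' := ⟨of 0, map_zero D⟩
  smul_mem' := by
    rintro c _ ⟨t, rfl⟩
    exact ⟨smul c t, rfl⟩

/-- The ambient lattice may live in a larger universe, but the sublattice is the image of the terms,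
which form a type in the universe of `E`. -/
instance [AddCommGroup E] [Module ℝ E] (D : E →ₗ[ℝ] Y) : Small.{u} (rangeEval D) :=
  small_range (eval D)

end LatticeTerm

namespace PBanachLattice

variable {p : ℝ} [hp : Fact (0 < p)] {E : Type u} [AddCommGroup E] [Module ℝ E]

/-- The closed sublattice generated by the range of a linear map `E → Y`, in the universe of `E`. -/
theorem exists_generated_sublattice {Y : PBanachLattice.{v} p} (D : E →ₗ[ℝ] Y) :
    ∃ (F : PBanachLattice.{u} p) (e : F →ₗ[ℝ] Y), PreservesLattice e ∧ (∀ x, ‖e x‖ = ‖x‖) ∧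
      Set.range e = Set.range (LatticeTerm.eval D) := by
  let j : Shrink.{u} (LatticeTerm.rangeEval D) →ₗ[ℝ] Y :=
    (LatticeTerm.rangeEval D).subtype ∘ₗ
      (Shrink.linearEquiv ℝ (LatticeTerm.rangeEval D)).toLinearMap
  have hr : Set.range j = Set.range (LatticeTerm.eval D) := by
    change Set.range ((LatticeTerm.rangeEval D).subtype ∘
      (Shrink.linearEquiv ℝ (LatticeTerm.rangeEval D))) = _
    rw [(Shrink.linearEquiv ℝ (LatticeTerm.rangeEval D)).surjective.range_comp]
    exact Subtype.range_coe
  obtain ⟨F, e, he, hn, hre⟩ := exists_of_injective j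
    ((LatticeTerm.rangeEval D).injective_subtype.comp (LinearEquiv.injective _))
    (fun a => by
      have h1 : j a ∈ Set.range (LatticeTerm.eval D) := hr ▸ Set.mem_range_self a
      obtain ⟨t, ht⟩ := h1
      have h2 : |j a| ∈ Set.range j := hr ▸ ⟨LatticeTerm.abs t, by rw [← ht]; rfl⟩
      exact h2)
    (hr ▸ LatticeTerm.isClosed_range_eval D)
  exact ⟨F, e, he, hn, hre.trans hr⟩

/-- Continuous lattice homomorphisms on a sublattice generated by `D` that agree on the generators
are equal. -/
theorem ext_of_generated {F : PBanachLattice.{u} p} {Y : PBanachLattice.{v} p}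
    {D : E →ₗ[ℝ] Y} {e : F →ₗ[ℝ] Y} (he : PreservesLattice e) (hn : ∀ x, ‖e x‖ = ‖x‖)
    (hr : Set.range e = Set.range (LatticeTerm.eval D)) {X : PBanachLattice.{w} p}
    {S S' : F →ₗ[ℝ] X} (hS : PreservesLattice S) (hSc : Continuous S)
    (hS' : PreservesLattice S') (hSc' : Continuous S')
    (h : ∀ a f, e f = D a → S' f = S f) : S' = S := by
  have hinj := injective_of_isometry hn
  have hex : ∀ t, ∃ f, e f = LatticeTerm.eval D t := fun t => by
    have : LatticeTerm.eval D t ∈ Set.range e := hr ▸ Set.mem_range_self t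
    exact this
  have key : ∀ t f, e f = LatticeTerm.eval D t → S' f = S f := by
    intro t
    induction t with
    | of a => exact h a
    | add s t hs ht =>
      intro f hf
      obtain ⟨a, ha⟩ := hex s
      obtain ⟨b, hb⟩ := hex t
      have : f = a + b := hinj (by rw [hf, map_add, ha, hb]; rfl)
      rw [this, map_add, map_add, hs a ha, ht b hb]
    | smul c t ht =>
      intro f hf
      obtain ⟨a, ha⟩ := hex t
      have : f = c • a := hinj (by rw [hf, map_smul, ha]; rfl)
      rw [this, map_smul, map_smul, ht a ha]
    | abs t ht =>
      intro f hf
      obtain ⟨a, ha⟩ := hex t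
      have : f = |a| := hinj (by rw [hf, he.map_abs, ha]; rfl)
      rw [this, hS.map_abs, hS'.map_abs, ht a ha]
    | lim s hs =>
      intro f hf
      by_cases hlim : ∃ y, Tendsto (fun n => LatticeTerm.eval D (s n)) atTop (𝓝 y)
      · obtain ⟨y, hy⟩ := hlim
        rw [LatticeTerm.eval_lim hy] at hf
        choose g hg using fun n => hex (s n)
        -- The isometry `e` reflects convergence, so continuity of `S` and `S'` can be used inside
        -- `F`.
        have hgf : Tendsto g atTop (𝓝 f) := by
          refine tendsto_iff.2 ((tendsto_iff.1 hy).congr fun n => ?_)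
          rw [← hg, ← hf, ← map_sub, hn]
        refine tendsto_nhds_unique ((hSc'.tendsto f).comp hgf) ?_
        refine ((hSc.tendsto f).comp hgf).congr fun n => ?_
        exact (hs n (g n) (hg n)).symm
      -- A divergent limit term has the default value `0`, on which linear maps agree.
      · rw [LatticeTerm.eval_lim_of_not_exists hlim] at hf
        have : f = 0 := hinj (hf.trans (map_zero e).symm)
        rw [this, map_zero, map_zero]
  ext f
  have hf : e f ∈ Set.range (LatticeTerm.eval D) := hr ▸ Set.mem_range_self f
  obtain ⟨t, ht⟩ := hf
  exact key t f ht.symm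

/-- The free `p`-Banach lattice exists over every `p`-Banach space that embeds isometrically in a
`p`-Banach lattice. -/
theorem exists_isFreePBL [Norm E] [IsPBanach p E] {X₀ : PBanachLattice.{u} p} (T₀ : E →ₗ[ℝ] X₀)
    (hT₀ : ∀ a, ‖T₀ a‖ = ‖a‖) :
    ∃ (F : PBanachLattice.{u} p) (δ : E →ₗ[ℝ] F), IsFreePBL F δ := by
  -- All contractions into all lattices of universe `u` are used. This index type lies one universe
  -- higher, and so does the product; the generated sublattice brings the construction back to `u`.
  let I := Σ X : PBanachLattice.{u} p, {T : E →ₗ[ℝ] X // ∀ a, ‖T a‖ ≤ ‖a‖}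
  let fam : I → PBanachLattice.{u} p := fun i => i.1
  obtain ⟨D, hD⟩ := pi.exists_lift (hp := hp.out) (X := fam) (fun i => i.2.1) fun i => i.2.2
  obtain ⟨F, e, he, hn, hr⟩ := exists_generated_sublattice D
  have hinj := injective_of_isometry hn
  have hDe : ∀ a, D a ∈ LinearMap.range e := fun a => by
    have : D a ∈ Set.range e := hr ▸ ⟨LatticeTerm.of a, rfl⟩
    exact this
  let δ : E →ₗ[ℝ] F := (LinearEquiv.ofInjective e hinj).symm.toLinearMap ∘ₗ D.codRestrict _ hDe
  have hδ : ∀ a, e (δ a) = D a := fun a =>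
    congrArg Subtype.val ((LinearEquiv.ofInjective e hinj).apply_symm_apply ⟨D a, hDe a⟩)
  have hδn : ∀ a, ‖δ a‖ = ‖a‖ := by
    intro a
    rw [← hn, hδ]
    refine le_antisymm (pi.norm_le (IsPBanach.norm_nonneg p a) fun i => ?_) ?_
    · rw [hD]; exact i.2.2 a
    -- The component at the isometric embedding `T₀` prevents `δ` from shrinking norms.
    · have h1 := pi.norm_proj_le (D a) (⟨X₀, T₀, fun a => (hT₀ a).le⟩ : I)
      rw [hD] at h1
      exact (hT₀ a).symm.le.trans h1
  refine ⟨F, δ, hδn, fun X T hT => ?_⟩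
  set c := opNorm T with hc
  have hc0 : 0 ≤ c := opNorm_nonneg p T
  have hTc : ∀ a, ‖T a‖ ≤ c * ‖a‖ := norm_le_opNorm_mul p hT
  -- `T` is normalized to a contraction, and `S` is `c` times the corresponding coordinate. If `c =
  -- 0`, then `T = 0` and the convention `0⁻¹ = 0` still gives a valid index.
  let i : I := ⟨X, c⁻¹ • T, fun a => by
    rw [LinearMap.smul_apply, X.norm_smul, abs_of_nonneg (inv_nonneg.2 hc0)]
    exact inv_mul_le_of_le_mul₀ hc0 (IsPBanach.norm_nonneg p a) (hTc a)⟩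
  let S : F →ₗ[ℝ] X := c • ((pi.proj i : pi hp.out fam →ₗ[ℝ] fam i) ∘ₗ e)
  have hSn : ∀ f, ‖S f‖ ≤ c * ‖f‖ := fun f => by
    change ‖c • (pi.proj i (e f) : X)‖ ≤ _
    rw [X.norm_smul, abs_of_nonneg hc0]
    exact mul_le_mul_of_nonneg_left ((pi.norm_proj_le (e f) i).trans (hn f).le) hc0
  have hSl : PreservesLattice S := preservesLattice_of_map_abs fun f => by
    change c • (pi.proj i (e |f|) : X) = |c • (pi.proj i (e f) : X)|
    rw [abs_smul_eq_abs_smul_abs, abs_of_nonneg hc0, he.map_abs,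
      (pi.preservesLattice_proj i).map_abs]
  have hSδ : ∀ a, S (δ a) = T a := fun a => by
    change c • (pi.proj i (e (δ a)) : X) = T a
    rw [hδ, hD]
    change c • c⁻¹ • T a = T a
    rcases hc0.eq_or_lt' with h0 | h0
    · have h1 := hTc a
      rw [h0, zero_mul] at h1
      rw [h0, zero_smul,
        IsPBanach.eq_zero_of_norm_eq_zero p _ (le_antisymm h1 (X.norm_nonneg _))]
    · rw [smul_smul, mul_inv_cancel₀ h0.ne', one_smul]
  have hSb : IsBoundedOp S := ⟨c, hSn⟩
  refine ⟨S, ⟨⟨hSl, hSb⟩, LinearMap.ext hSδ⟩, le_antisymm (opNorm_le_of_bound p hc0 hSn) ?_,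
    fun S' hS' hS'δ => ?_⟩
  · refine opNorm_le_of_bound p (opNorm_nonneg p S) fun a => ?_
    rw [← hSδ, ← hδn]
    exact norm_le_opNorm_mul p hSb (δ a)
  · refine ext_of_generated he hn hr hSl hSb.continuous hS'.1 hS'.2.continuous fun a f hf => ?_
    have h1 : f = δ a := hinj (hf.trans (hδ a).symm)
    rw [h1, hSδ]
    exact LinearMap.congr_fun hS'δ a

end PBanachLattice

/-- A projective object is a lattice-complemented sublattice of the free lattice over it. -/
theorem IsFreePBL.isLatticeComplemented {p : ℝ} {P F : PBanachLattice.{u} p} {δ : P →ₗ[ℝ] F}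
    (hF : IsFreePBL F δ) {l : ℝ} (hP : IsProjectiveConst (fun _ => True) l P) :
    IsLatticeComplemented P F := by
  have hid : IsLatticeHom (LinearMap.id : P →ₗ[ℝ] P) :=
    ⟨⟨fun _ _ => rfl, fun _ _ => rfl⟩, 1, fun x => by simp⟩
  obtain ⟨β, ⟨hβ, hβδ⟩, hβn, -⟩ := hF.2 P LinearMap.id hid.2
  have hβδ' : ∀ z, β (δ z) = z := LinearMap.congr_fun hβδ
  have hβ1 : ∀ f, ‖β f‖ ≤ ‖f‖ := fun f => by
    refine (norm_le_opNorm_mul p hβ.2 f).trans (mul_le_of_le_one_left (F.norm_nonneg f) ?_)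
    rw [hβn]
    exact opNorm_le_of_bound p zero_le_one fun x => by simp
  -- `β` is a contraction and `δ` is an isometric linear section of it, so the quotient norm at `z`
  -- is attained at `δ z`.
  have hq : IsLatticeQuotient β := by
    refine ⟨hβ, fun z => ⟨δ z, hβδ' z⟩, fun z => ⟨?_, fun r hr => ?_⟩⟩
    · rintro _ ⟨f, rfl, rfl⟩
      exact hβ1 f
    · exact (hr ⟨δ z, hβδ' z, rfl⟩).trans (hF.1 z).le
  obtain ⟨α, hα, hβα, -⟩ := hP F P trivial trivial β hq LinearMap.id hid
  exact ⟨α, β, hα, hβ, hβα⟩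

theorem mainTheorem3 {p : ℝ} (hp : 0 < p) (hp1 : p < 1) (Γ : Type*) :
    (IsProjectivePBL (ellp hp hp1.le Γ) ↔ Countable Γ) ∧
    (IsProjectiveConvexPBL hp (ellp hp hp1.le Γ) ↔ Countable Γ) ∧
    (Countable Γ →
      (∃ (F : PBanachLattice p) (δ : ellp hp hp1.le Γ →ₗ[ℝ] F), IsFreePBL F δ) ∧
      ∀ (F : PBanachLattice p) (δ : ellp hp hp1.le Γ →ₗ[ℝ] F), IsFreePBL F δ →
        IsLatticeComplemented (ellp hp hp1.le Γ) F) := by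
  have : Fact (0 < p) := ⟨hp⟩
  refine ⟨⟨fun ⟨l, _, h⟩ => ?_, fun _ => ?_⟩, ⟨fun ⟨_, l, _, h⟩ => ?_, fun _ => ?_⟩,
    fun _ => ⟨?_, fun F δ hF => ?_⟩⟩
  · exact ellp.countable_of_isProjectiveConst (hp1 := hp1) (fun _ _ => trivial) h
  · exact ⟨2, one_le_two, ellp.isProjectiveConst_of_countable _⟩
  · exact ellp.countable_of_isProjectiveConst (hp1 := hp1) (fun _ hX => hX.isPConvex) h
  · exact ⟨(ellp.isPConvexOne hp1).isPConvex, 2, one_le_two,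
      ellp.isProjectiveConst_of_countable _⟩
  · exact PBanachLattice.exists_isFreePBL LinearMap.id fun _ => rfl
  · exact hF.isLatticeComplemented (ellp.isProjectiveConst_of_countable _)
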